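/- For $n\ge 0$ let $\mathcal U$ denote the uniform distribution on $\{-1,1\}^n$. A distribution $\mathcal D$ on $\{-1,1\}^n$ is $k$-wise independent if its marginal on every set of at most $k$ coordinates is uniform, and it $\varepsilon$-fools $f:\{-1,1\}^n\to\{-1,1\}$ if $|\mathbf E_{x\sim\mathcal D}[f(x)]-\mathbf E_{x\sim\mathcal U}[f(x)]|\le\varepsilon$. We say that $k$-wise independence $\varepsilon$-fools a class of functions on $\{-1,1\}^n$ if every $k$-wise independent distribution on $\{-1,1\}^n$ $\varepsilon$-fools every function of the class. A degree-$d$ PTF is a function $f(x)=\mathrm{sgn}(p(x))$ on $\{-1,1\}^n$, where $p$ is a real polynomial in $n$ variables of degree at most $d$, and $\mathrm{sgn}(t)=-1$ for $t<0$, $\mathrm{sgn}(t)=1$ for $t\ge 0$. With $\widehat p_S=\mathbf E_{x\sim\mathcal U}[p(x)\prod_{i\in S}x_i]$, $\mathrm{Inf}_i(p)=\sum_{S\ni i}\widehat p_S^{\,2}$ and $\mathrm{Inf}(p)=\sum_i\mathrm{Inf}_i(p)$, the polynomial $p$ is $\tau$-regular if $\mathrm{Inf}_i(p)\le\tau\,\mathrm{Inf}(p)$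 for all $i$, and a $\tau$-regular degree-$d$ PTF is a function $\mathrm{sgn}(p)$ with $p$ a $\tau$-regular polynomial of degree at most $d$. **Theorem.** For every $\eta>0$ there is a constant $C\in\mathbb N$, depending only on $\eta$, such that the following holds for all integers $d\ge 1$, $n,K_d\ge 0$ and all reals $0<\tau\le\varepsilon$. If $K_d$-wise independence $\varepsilon$-fools the class of $\tau$-regular degree-$d$ PTFs on $\{-1,1\}^n$, then $(K_d+L_d)$-wise independence $(1+\eta)\varepsilon$-fools the class of all degree-$d$ PTFs on $\{-1,1\}^n$, where $$L_d=\Big\lceil \tfrac1\tau\big(d\cdot\max\{2,\ln(1/\tau)\}\big)^{Cd}\Big\rceil .$$ In particular $L_d=(1/\tau)\,(d\log(1/\tau))^{O(d)}$, with a constant in $O(\cdot)$ depending only on $\eta$, as long as $\tau\le 1/4$. -/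

import Mathlib

/-- The hypercube `{-1,1}^n`; the two units of `ℤ` are exactly `1` and `-1`. -/
abbrev Cube (n : ℕ) : Type := Fin n → ℤˣ

/-- A sign read as a real number. -/
def signVal (u : ℤˣ) : ℝ := ((u : ℤ) : ℝ)

/-- `sgn` is `-1` for negative arguments and `1` otherwise. -/
noncomputable def sgn (t : ℝ) : ℤˣ := if t < 0 then -1 else 1

/-- The expectation `E_{x ∼ D}[g(x)]` for a distribution `D` on the hypercube. -/
noncomputable def expect {n : ℕ} (D : PMF (Cube n)) (g : Cube n → ℝ) : ℝ :=
  ∑ x, (D x).toReal * g x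

/-- `D` is `k`-wise independent: its marginal on any at most `k` coordinates is uniform.
(For `k ≤ n` this is the same as requiring it for exactly `k` coordinates; for `k ≥ n` it says
that `D` is the uniform distribution.) -/
def IsKWiseIndependent {n : ℕ} (k : ℕ) (D : PMF (Cube n)) : Prop :=
  ∀ S : Finset (Fin n), S.card ≤ k →
    D.map (fun (x : Cube n) (i : S) => x i) = PMF.uniformOfFintype (S → ℤˣ)

/-- `D` fools the boolean function `f` with error `ε`. -/
def Fools {n : ℕ} (ε : ℝ) (D : PMF (Cube n)) (f : Cube n → ℤˣ) : Prop :=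
  |expect D (fun x => signVal (f x)) -
    expect (PMF.uniformOfFintype (Cube n)) (fun x => signVal (f x))| ≤ ε

/-- `k`-wise independence `ε`-fools a class of boolean functions: every `k`-wise independent
distribution `ε`-fools every function of the class. -/
def KWiseFools {n : ℕ} (k : ℕ) (ε : ℝ) (F : Set (Cube n → ℤˣ)) : Prop :=
  ∀ D : PMF (Cube n), IsKWiseIndependent k D → ∀ f ∈ F, Fools ε D f

/-- A real polynomial as a function on the hypercube. -/
noncomputable def evalCube {n : ℕ} (p : MvPolynomial (Fin n) ℝ) (x : Cube n) : ℝ :=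
  MvPolynomial.eval (fun i => signVal (x i)) p

/-- The Fourier-Walsh coefficient of `g` at `S`: the expectation of `g(x) ∏_{i ∈ S} x_i` under
the uniform distribution. -/
noncomputable def fourierWalsh {n : ℕ} (g : Cube n → ℝ) (S : Finset (Fin n)) : ℝ :=
  expect (PMF.uniformOfFintype (Cube n)) (fun x => g x * ∏ i ∈ S, signVal (x i))

/-- The influence of the variable `i` on `g`. -/
noncomputable def influence {n : ℕ} (g : Cube n → ℝ) (i : Fin n) : ℝ :=
  ∑ S : Finset (Fin n) with i ∈ S, fourierWalsh g S ^ 2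

/-- The total influence of `g`. -/
noncomputable def totalInfluence {n : ℕ} (g : Cube n → ℝ) : ℝ :=
  ∑ i, influence g i

/-- `g` is `τ`-regular. -/
def IsTauRegular {n : ℕ} (τ : ℝ) (g : Cube n → ℝ) : Prop :=
  ∀ i, influence g i ≤ τ * totalInfluence g

/-- The class of degree-`d` polynomial threshold functions on `{-1,1}^n`. -/
def degreePTF (n d : ℕ) : Set (Cube n → ℤˣ) :=
  {f | ∃ p : MvPolynomial (Fin n) ℝ, p.totalDegree ≤ d ∧ ∀ x, f x = sgn (evalCube p x)}

/-- The class of `τ`-regular degree-`d` polynomial threshold functions on `{-1,1}^n`. -/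
def regularPTF (n d : ℕ) (τ : ℝ) : Set (Cube n → ℤˣ) :=
  {f | ∃ p : MvPolynomial (Fin n) ℝ, p.totalDegree ≤ d ∧ IsTauRegular τ (evalCube p) ∧
    ∀ x, f x = sgn (evalCube p x)}

/-- The extra independence `(1/τ) (d log(1/τ))^{C d}`, rounded up to an integer. The factor
`log (1/τ)` is replaced by `2` where it is smaller than `2`, that is, for `τ > e⁻²`, so that the
base of the power stays bounded away from `1`. -/
noncomputable def extraIndependence (C d : ℕ) (τ : ℝ) : ℕ :=
  ⌈(1 / τ) * ((d : ℝ) * max 2 (Real.log (1 / τ))) ^ (C * d)⌉₊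

open scoped BigOperators symmDiff

namespace PTF

variable {n : ℕ}

/-! ### Walsh functions -/

/-! The proof replaces an arbitrary polynomial by random restrictions of it. A function on the cube
is called good (`IsGood`) if it is τ-regular or if its squared mean is far larger than its variance.
Good functions are easy: the regular ones are fooled by hypothesis, and for the others Chebyshev's
inequality, valid under 2d-wise independence since it only involves a square, shows that the sign is
nearly constant under both distributions.

The core is that every g of degree d has a set H of at most m coordinates such that fixing H at
random gives a good function with probability at least 1/(32·9^d) (`exists_le_prob_isGood`). H is
built greedily, adding a coordinate as long as it carries more than a fraction t of the influence
outside H. If this stops early, hypercontractivity bounds the q-th moments of the restricted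
influences, so by Markov all of them are likely small, while Paley-Zygmund keeps the total influence
large with probability about 9^(-d): a regular restriction results (`le_prob_isTauRegular`). If it
runs for m steps, the influence outside H, and with it the average variance of the restrictions, is
tiny, while Paley-Zygmund keeps the squared mean large (`le_prob_concentrated`).

Bad restrictions are restricted again. After r rounds their weight is at most (1 - c)^r with c =
1/(32·9^d), and each round costs m units of independence, because conditioning on few coordinates of
a distribution of limited independence preserves the remaining independence (`exists_restricted`,
`abs_expect_sub_le`).

The dependence on τ is linear in 1/τ because q is large: the moment bound forces t to be of order
τ^(q/(q-1)), up to factors depending on d and q, so q = 2 would cost 1/τ². With q polynomial in N,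
where N is about d·log(1/τ), one may take t = τ/(32(2q)^d). Then m is about N/t and r about 9^d·N,
and r·m is (1/τ)·N^(O(d)). -/

/-- The Walsh function `χ_S(x) = ∏_{i ∈ S} x_i`. -/
noncomputable def walsh (S : Finset (Fin n)) (x : Cube n) : ℝ := ∏ i ∈ S, signVal (x i)

lemma signVal_mul_self (u : ℤˣ) : signVal u * signVal u = 1 := by
  rcases Int.units_eq_one_or u with rfl | rfl <;> simp [signVal]

lemma signVal_neg (u : ℤˣ) : signVal (-u) = -signVal u := by simp [signVal]

lemma walsh_empty (x : Cube n) : walsh ∅ x = 1 := by simp [walsh]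

lemma walsh_mul_self (S : Finset (Fin n)) (x : Cube n) : walsh S x * walsh S x = 1 := by
  simp [walsh, ← Finset.prod_mul_distrib, signVal_mul_self]

lemma walsh_union {S T : Finset (Fin n)} (h : Disjoint S T) (x : Cube n) :
    walsh (S ∪ T) x = walsh S x * walsh T x := Finset.prod_union h

lemma walsh_insert {S : Finset (Fin n)} {a : Fin n} (h : a ∉ S) (x : Cube n) :
    walsh (insert a S) x = signVal (x a) * walsh S x := Finset.prod_insert h

lemma walsh_mul (S T : Finset (Fin n)) (x : Cube n) :
    walsh S x * walsh T x = walsh (S ∆ T) x := by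
  have hS : walsh S x = walsh (S \ T) x * walsh (S ∩ T) x := by
    rw [← walsh_union (Finset.disjoint_sdiff_inter S T), Finset.sdiff_union_inter]
  have hT : walsh T x = walsh (T \ S) x * walsh (S ∩ T) x := by
    rw [Finset.inter_comm, ← walsh_union (Finset.disjoint_sdiff_inter T S),
      Finset.sdiff_union_inter]
  rw [symmDiff_def, Finset.sup_eq_union, walsh_union disjoint_sdiff_sdiff, hS, hT]
  linear_combination (walsh (S \ T) x * walsh (T \ S) x) * walsh_mul_self (S ∩ T) x

/-- Flipping the coordinate `a` of a point of the cube. -/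
def flip (a : Fin n) (x : Cube n) : Cube n := Function.update x a (-x a)

lemma flip_flip (a : Fin n) (x : Cube n) : flip a (flip a x) = x := by simp [flip]

lemma flip_same (a : Fin n) (x : Cube n) : flip a x a = -x a := by simp [flip]

lemma flip_of_ne {a i : Fin n} (h : i ≠ a) (x : Cube n) : flip a x i = x i := by simp [flip, h]

/-- Flipping a coordinate, as an equivalence. -/
def flipEquiv (a : Fin n) : Cube n ≃ Cube n where
  toFun := flip a
  invFun := flip a
  left_inv := flip_flip a
  right_inv := flip_flip a

lemma walsh_flip_of_notMem {S : Finset (Fin n)} {a : Fin n} (h : a ∉ S) (x : Cube n) :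
    walsh S (flip a x) = walsh S x :=
  Finset.prod_congr rfl fun i hi => by
    rw [flip_of_ne (by rintro rfl; exact h hi)]

lemma walsh_flip_of_mem {S : Finset (Fin n)} {a : Fin n} (h : a ∈ S) (x : Cube n) :
    walsh S (flip a x) = -walsh S x := by
  rw [← Finset.insert_erase h, walsh_insert (Finset.notMem_erase a S),
    walsh_insert (Finset.notMem_erase a S), walsh_flip_of_notMem (Finset.notMem_erase a S),
    flip_same, signVal_neg, neg_mul]

lemma expect_flip (a : Fin n) (F : Cube n → ℝ) : 𝔼 x, F (flip a x) = 𝔼 x, F x :=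
  Fintype.expect_equiv (flipEquiv a) _ _ fun _ => rfl

lemma expect_walsh (S : Finset (Fin n)) : 𝔼 x, walsh S x = if S = ∅ then 1 else 0 := by
  split_ifs with h
  · subst h; simp [walsh_empty]
  · obtain ⟨a, ha⟩ := Finset.nonempty_iff_ne_empty.mpr h
    have := expect_flip a (walsh S)
    simp only [walsh_flip_of_mem ha, Finset.expect_neg_distrib] at this
    linarith

lemma expect_walsh_mul (S T : Finset (Fin n)) :
    𝔼 x, walsh S x * walsh T x = if S = T then 1 else 0 := by
  simp only [walsh_mul, expect_walsh]
  congr 1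
  rw [← Finset.bot_eq_empty, symmDiff_eq_bot]

/-! ### Hypercontractivity -/

/-- Coefficientwise form of `two_point`. From k to k + 1 the left side grows by
(q-k)(2q-2k-1)/((k+1)(2k+1)), the right side by (q-k)(2q-1)/(k+1), which is at least as large. -/
lemma choose_two_mul_le (q k : ℕ) (hk : k ≤ q) :
    ((2 * q).choose (2 * k) : ℝ) ≤ q.choose k * (2 * q - 1) ^ k := by
  induction k with
  | zero => simp
  | succ k ih =>
    have ih := ih (by omega)
    have hkq : (k : ℝ) + 1 ≤ q := by exact_mod_cast hk
    have hk0 : (0 : ℝ) ≤ k := k.cast_nonneg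
    have e1 : ((2 * q).choose (2 * k + 1) : ℝ) * (2 * k + 1) =
        (2 * q).choose (2 * k) * (2 * q - 2 * k) := by
      have := Nat.choose_succ_right_eq (2 * q) (2 * k)
      have h2 := congrArg (Nat.cast : ℕ → ℝ) this
      rw [Nat.cast_mul, Nat.cast_mul, Nat.cast_sub (by omega)] at h2
      push_cast at h2; exact h2
    have e2 : ((2 * q).choose (2 * (k + 1)) : ℝ) * (2 * k + 2) =
        (2 * q).choose (2 * k + 1) * (2 * q - 2 * k - 1) := by
      have := Nat.choose_succ_right_eq (2 * q) (2 * k + 1)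
      have h2 := congrArg (Nat.cast : ℕ → ℝ) this
      rw [Nat.cast_mul, Nat.cast_mul, Nat.cast_sub (by omega)] at h2
      push_cast at h2
      rw [show 2 * (k + 1) = 2 * k + 1 + 1 by ring]
      linear_combination h2
    have e3 : (q.choose (k + 1) : ℝ) * (k + 1) = q.choose k * (q - k) := by
      have := Nat.choose_succ_right_eq q k
      have h2 := congrArg (Nat.cast : ℕ → ℝ) this
      rw [Nat.cast_mul, Nat.cast_mul, Nat.cast_sub (by omega)] at h2
      push_cast at h2; exact h2
    have e4 : ((2 * q).choose (2 * (k + 1)) : ℝ) * ((k + 1) * (2 * k + 1)) =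
        (2 * q).choose (2 * k) * ((q - k) * (2 * q - 2 * k - 1)) := by
      linear_combination (1 / 2) * (2 * k + 1) * e2 + (1 / 2) * (2 * q - 2 * k - 1 : ℝ) * e1
    have hpos : (0 : ℝ) < (k + 1) * (2 * k + 1) := by positivity
    refine le_of_mul_le_mul_right ?_ hpos
    rw [e4, pow_succ]
    calc ((2 * q).choose (2 * k) : ℝ) * ((q - k) * (2 * q - 2 * k - 1))
        ≤ (q.choose k * (2 * q - 1) ^ k) * ((q - k) * (2 * q - 2 * k - 1)) :=
          mul_le_mul_of_nonneg_right ih (mul_nonneg (by linarith) (by linarith))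
      _ = (q.choose k * (q - k)) * ((2 * q - 1) ^ k * (2 * q - 2 * k - 1)) := by ring
      _ = (q.choose (k + 1) * (k + 1)) * ((2 * q - 1) ^ k * (2 * q - 2 * k - 1)) := by rw [e3]
      _ ≤ (q.choose (k + 1) * (k + 1)) * ((2 * q - 1) ^ k * ((2 * q - 1) * (2 * k + 1))) := by
          have h1 : (0 : ℝ) ≤ (2 * q - 1) ^ k := pow_nonneg (by linarith) k
          have h2 : (2 * q - 2 * k - 1 : ℝ) ≤ (2 * q - 1) * (2 * k + 1) := by nlinarith
          gcongr
      _ = _ := by ring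

lemma sum_range_two_mul_succ (f : ℕ → ℝ) (q : ℕ) :
    ∑ j ∈ Finset.range (2 * q + 1), f j =
      ∑ k ∈ Finset.range (q + 1), f (2 * k) + ∑ k ∈ Finset.range q, f (2 * k + 1) := by
  induction q with
  | zero => simp
  | succ q ih =>
    rw [show 2 * (q + 1) + 1 = 2 * q + 1 + 1 + 1 by ring, Finset.sum_range_succ,
      Finset.sum_range_succ, ih, Finset.sum_range_succ _ (q + 1), Finset.sum_range_succ _ q,
      Finset.sum_range_succ _ q]
    rw [show 2 * (q + 1) = 2 * q + 1 + 1 by ring]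
    ring

/-- The two-point inequality behind hypercontractivity. -/
lemma two_point (q : ℕ) (P Q : ℝ) :
    ((P + Q) ^ (2 * q) + (P - Q) ^ (2 * q)) / 2 ≤ (P ^ 2 + (2 * q - 1) * Q ^ 2) ^ q := by
  have h1 : ((P + Q) ^ (2 * q) + (P - Q) ^ (2 * q)) / 2 =
      ∑ k ∈ Finset.range (q + 1), (Q ^ 2) ^ k * (P ^ 2) ^ (q - k) * (2 * q).choose (2 * k) := by
    rw [sub_eq_add_neg, add_comm P Q, add_comm P (-Q), add_pow, add_pow,
      sum_range_two_mul_succ, sum_range_two_mul_succ]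
    have e : ∀ k, (-Q) ^ (2 * k + 1) = -Q ^ (2 * k + 1) := fun k =>
      Odd.neg_pow ⟨k, rfl⟩ Q
    have e' : ∀ k, (-Q) ^ (2 * k) = Q ^ (2 * k) := fun k => by rw [pow_mul, neg_sq, ← pow_mul]
    simp only [e, e', neg_mul, Finset.sum_neg_distrib]
    rw [show ∀ a b : ℝ, (a + b + (a + -b)) / 2 = a from fun a b => by ring]
    refine Finset.sum_congr rfl fun k _ => ?_
    rw [← pow_mul, ← pow_mul, Nat.mul_sub]
  rw [h1, add_comm (P ^ 2), add_pow]
  refine Finset.sum_le_sum fun k hk => ?_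
  have := choose_two_mul_le q k (by simpa [Nat.lt_succ_iff] using hk)
  calc (Q ^ 2) ^ k * (P ^ 2) ^ (q - k) * (2 * q).choose (2 * k)
      ≤ (Q ^ 2) ^ k * (P ^ 2) ^ (q - k) * (q.choose k * (2 * q - 1) ^ k) := by gcongr
    _ = _ := by rw [mul_pow]; ring

/-- Minkowski's inequality in the form of a bound on a sum. -/
lemma expect_add_pow_le {ι : Type*} [Fintype ι] {q : ℕ} (hq : q ≠ 0) {X Y : ι → ℝ} {A B : ℝ}
    (hX : ∀ i, 0 ≤ X i) (hY : ∀ i, 0 ≤ Y i) (hA : 0 ≤ A) (hB : 0 ≤ B)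
    (h1 : 𝔼 i, X i ^ q ≤ A ^ q) (h2 : 𝔼 i, Y i ^ q ≤ B ^ q) :
    𝔼 i, (X i + Y i) ^ q ≤ (A + B) ^ q := by
  have key : ∀ {Z : ι → ℝ}, (∀ i, 0 ≤ Z i) → 𝔼 i, Z i ^ q ≤ 0 ^ q → Z = 0 := by
    intro Z hZ h
    rw [zero_pow hq] at h
    have h0 : 𝔼 i, Z i ^ q = 0 :=
      le_antisymm h (Finset.expect_nonneg fun i _ => pow_nonneg (hZ i) q)
    have := (Fintype.expect_eq_zero_iff_of_nonneg (fun i => pow_nonneg (hZ i) q)).mp h0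
    funext i
    exact pow_eq_zero_iff hq |>.mp (congrFun this i)
  rcases hA.eq_or_lt with rfl | hA
  · have := key hX h1; subst this; simpa using h2
  rcases hB.eq_or_lt with rfl | hB
  · have := key hY h2; subst this; simpa using h1
  have hAB : 0 < A + B := by positivity
  -- Convexity of t^q at the points X/A and Y/B with weights A/(A+B) and B/(A+B); the degenerate
  -- cases A = 0 and B = 0 are already gone.
  have pt : ∀ i, (X i + Y i) ^ q ≤
      (A + B) ^ q * (A / (A + B) * (X i ^ q / A ^ q) + B / (A + B) * (Y i ^ q / B ^ q)) := by
    intro i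
    have hcv : ConvexOn ℝ (Set.Ici 0) fun t : ℝ => t ^ q := convexOn_pow q
    have hc := hcv.2 (Set.mem_Ici.mpr (div_nonneg (hX i) hA.le))
      (Set.mem_Ici.mpr (div_nonneg (hY i) hB.le))
      (show 0 ≤ A / (A + B) by positivity) (show 0 ≤ B / (A + B) by positivity) (by field_simp)
    simp only [smul_eq_mul, div_pow] at hc
    refine le_trans (le_of_eq ?_) (mul_le_mul_of_nonneg_left hc (pow_nonneg hAB.le q))
    rw [← mul_pow]
    congr 1
    field_simp
  calc 𝔼 i, (X i + Y i) ^ q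
      ≤ 𝔼 i, (A + B) ^ q * (A / (A + B) * (X i ^ q / A ^ q) + B / (A + B) * (Y i ^ q / B ^ q)) :=
        Finset.expect_le_expect fun i _ => pt i
    _ = (A + B) ^ q * (A / (A + B) * ((𝔼 i, X i ^ q) / A ^ q) +
          B / (A + B) * ((𝔼 i, Y i ^ q) / B ^ q)) := by
        rw [← Finset.mul_expect, Finset.expect_add_distrib, ← Finset.mul_expect,
          ← Finset.mul_expect, Finset.expect_div, Finset.expect_div]
    _ ≤ (A + B) ^ q * (A / (A + B) * 1 + B / (A + B) * 1) := by
        have h3 : (𝔼 i, X i ^ q) / A ^ q ≤ 1 := (div_le_one (by positivity)).mpr h1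
        have h4 : (𝔼 i, Y i ^ q) / B ^ q ≤ 1 := (div_le_one (by positivity)).mpr h2
        gcongr
    _ = (A + B) ^ q := by field_simp

/-- Hypercontractivity from L² to L^(2q), by induction on the coordinates. Isolating the coordinate
a, the function is P + x_a Q with P and Q independent of x_a. Averaging over the sign x_a and
applying `two_point` leaves P² + (2q-1)Q², whose L^q norm Minkowski bounds by those of P² and Q². -/
lemma expect_walsh_sum_pow_le {q : ℕ} (hq : q ≠ 0) (V : Finset (Fin n)) :
    ∀ c : Finset (Fin n) → ℝ, 𝔼 x, (∑ S ∈ V.powerset, c S * walsh S x) ^ (2 * q) ≤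
      (∑ S ∈ V.powerset, (2 * q - 1 : ℝ) ^ S.card * c S ^ 2) ^ q := by
  have hq1 : (1 : ℝ) ≤ q := by exact_mod_cast Nat.one_le_iff_ne_zero.mpr hq
  have hq2 : (0 : ℝ) ≤ 2 * q - 1 := by linarith
  induction V using Finset.induction_on with
  | empty => intro c; simp [walsh_empty, pow_mul]
  | insert a V ha ih =>
    intro c
    have hmem : ∀ S ∈ V.powerset, a ∉ S := fun S hS h => ha (Finset.mem_powerset.mp hS h)
    set P : Cube n → ℝ := fun x => ∑ S ∈ V.powerset, c S * walsh S x with hP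
    set Q : Cube n → ℝ := fun x => ∑ S ∈ V.powerset, c (insert a S) * walsh S x with hQ
    have hPf : ∀ x, P (flip a x) = P x := fun x =>
      Finset.sum_congr rfl fun S hS => by rw [walsh_flip_of_notMem (hmem S hS)]
    have hQf : ∀ x, Q (flip a x) = Q x := fun x =>
      Finset.sum_congr rfl fun S hS => by rw [walsh_flip_of_notMem (hmem S hS)]
    have hsplit : ∀ x, ∑ S ∈ (insert a V).powerset, c S * walsh S x =
        P x + signVal (x a) * Q x := by
      intro x
      rw [Finset.sum_powerset_insert ha, Finset.mul_sum]
      congr 1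
      exact Finset.sum_congr rfl fun S hS => by rw [walsh_insert (hmem S hS)]; ring
    have hsum : ∑ S ∈ (insert a V).powerset, (2 * q - 1 : ℝ) ^ S.card * c S ^ 2 =
        ∑ S ∈ V.powerset, (2 * q - 1 : ℝ) ^ S.card * c S ^ 2 +
        (2 * q - 1) * ∑ S ∈ V.powerset, (2 * q - 1 : ℝ) ^ S.card * c (insert a S) ^ 2 := by
      rw [Finset.sum_powerset_insert ha, Finset.mul_sum]
      congr 1
      exact Finset.sum_congr rfl fun S hS => by
        rw [Finset.card_insert_of_notMem (hmem S hS)]; ring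
    have hsym : 𝔼 x, (P x + signVal (x a) * Q x) ^ (2 * q) =
        𝔼 x, ((P x + Q x) ^ (2 * q) + (P x - Q x) ^ (2 * q)) / 2 := by
      have h1 := expect_flip a fun x => (P x + signVal (x a) * Q x) ^ (2 * q)
      simp only [hPf, hQf, flip_same, signVal_neg] at h1
      have h2 : ∀ x, ((P x + Q x) ^ (2 * q) + (P x - Q x) ^ (2 * q)) / 2 =
          ((P x + signVal (x a) * Q x) ^ (2 * q) + (P x + -signVal (x a) * Q x) ^ (2 * q)) / 2 := by
        intro x
        rcases Int.units_eq_one_or (x a) with h | h <;> simp only [h, signVal] <;> push_cast <;>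
          ring
      simp only [h2]
      rw [← Finset.expect_div, Finset.expect_add_distrib, h1]
      ring
    simp only [hsplit, hsum]
    rw [hsym]
    have hnn : ∀ c : Finset (Fin n) → ℝ,
        0 ≤ ∑ S ∈ V.powerset, (2 * q - 1 : ℝ) ^ S.card * c S ^ 2 := fun c =>
      Finset.sum_nonneg fun S _ => mul_nonneg (pow_nonneg hq2 _) (sq_nonneg _)
    refine (Finset.expect_le_expect fun x _ => two_point q (P x) (Q x)).trans ?_
    refine expect_add_pow_le hq (fun x => sq_nonneg _) (fun x => mul_nonneg hq2 (sq_nonneg _))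
      (hnn c) (mul_nonneg hq2 (hnn fun S => c (insert a S))) ?_ ?_
    · simpa only [← pow_mul] using ih c
    · simp only [mul_pow _ (_ ^ 2), ← pow_mul, ← Finset.mul_expect]
      rw [mul_pow]
      exact mul_le_mul_of_nonneg_left (ih fun S => c (insert a S)) (pow_nonneg hq2 _)

/-! ### Fourier analysis on the cube -/

lemma expect_uniform (g : Cube n → ℝ) :
    expect (PMF.uniformOfFintype (Cube n)) g = 𝔼 x, g x := by
  simp only [expect, PMF.uniformOfFintype_apply, ENNReal.toReal_inv, ENNReal.toReal_natCast]
  rw [← Finset.mul_sum, Fintype.expect_eq_sum_div_card, div_eq_inv_mul]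

lemma fourierWalsh_eq (g : Cube n → ℝ) (S : Finset (Fin n)) :
    fourierWalsh g S = 𝔼 x, g x * walsh S x := expect_uniform _

lemma fourierWalsh_empty (g : Cube n → ℝ) : fourierWalsh g ∅ = 𝔼 x, g x := by
  simp [fourierWalsh_eq, walsh_empty]

lemma sum_walsh_mul (x y : Cube n) :
    ∑ S, walsh S x * walsh S y = if x = y then (Fintype.card (Cube n) : ℝ) else 0 := by
  have h : ∑ S, walsh S x * walsh S y = ∏ i, (1 + signVal (x i) * signVal (y i)) := by
    rw [Finset.prod_one_add, Finset.powerset_univ]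
    exact Finset.sum_congr rfl fun S _ => Finset.prod_mul_distrib.symm
  rw [h]
  split_ifs with hxy
  · subst hxy
    simp only [signVal_mul_self, Finset.prod_const]
    simp [Fintype.card_pi, Fintype.card_units_int]
    norm_num
  · obtain ⟨i, hi⟩ := Function.ne_iff.mp hxy
    refine Finset.prod_eq_zero (Finset.mem_univ i) ?_
    rw [← neg_eq_iff_eq_neg.mpr (Int.units_ne_iff_eq_neg.mp hi), signVal_neg]
    linear_combination -signVal_mul_self (x i)

lemma fourier_expansion (g : Cube n → ℝ) (y : Cube n) :
    g y = ∑ S, fourierWalsh g S * walsh S y := by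
  simp only [fourierWalsh_eq, Finset.expect_mul]
  rw [← Finset.expect_sum_comm]
  simp only [mul_assoc, ← Finset.mul_sum, sum_walsh_mul]
  rw [Fintype.expect_eq_sum_div_card]
  simp

lemma parseval (g : Cube n → ℝ) : 𝔼 x, g x ^ 2 = ∑ S, fourierWalsh g S ^ 2 := by
  have h : ∀ x, g x ^ 2 = ∑ S, fourierWalsh g S * (g x * walsh S x) := fun x => by
    conv_lhs => rw [pow_two]; lhs; rw [fourier_expansion g x]
    rw [Finset.sum_mul]
    exact Finset.sum_congr rfl fun S _ => by ring
  simp only [h]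
  rw [Finset.expect_sum_comm]
  simp only [← Finset.mul_expect, ← fourierWalsh_eq, pow_two]

/-- All Fourier-Walsh coefficients of `g` above level `d` vanish. -/
def HasDegLE (d : ℕ) (g : Cube n → ℝ) : Prop :=
  ∀ S : Finset (Fin n), d < S.card → fourierWalsh g S = 0

lemma hypercontractive {d q : ℕ} (hq : q ≠ 0) {g : Cube n → ℝ} (hg : HasDegLE d g) :
    𝔼 x, (g x ^ 2) ^ q ≤ ((2 * q - 1 : ℝ) ^ d * 𝔼 x, g x ^ 2) ^ q := by
  have hq1 : (1 : ℝ) ≤ q := by exact_mod_cast Nat.one_le_iff_ne_zero.mpr hq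
  have h := expect_walsh_sum_pow_le hq Finset.univ (fourierWalsh g)
  simp only [Finset.powerset_univ, ← fourier_expansion, pow_mul] at h
  refine h.trans (pow_le_pow_left₀ (Finset.sum_nonneg fun S _ =>
    mul_nonneg (pow_nonneg (by linarith) _) (sq_nonneg _)) ?_ q)
  rw [parseval, Finset.mul_sum]
  refine Finset.sum_le_sum fun S _ => ?_
  rcases le_or_gt S.card d with hS | hS
  · exact mul_le_mul_of_nonneg_right (pow_le_pow_right₀ (by linarith) hS) (sq_nonneg _)
  · simp [hg S hS]

/-! ### Influences -/

/-- The discrete derivative of `g` in the direction `i`. -/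
noncomputable def coordDeriv (i : Fin n) (g : Cube n → ℝ) (x : Cube n) : ℝ :=
  (g x - g (flip i x)) / 2

lemma fourierWalsh_coordDeriv (i : Fin n) (g : Cube n → ℝ) (S : Finset (Fin n)) :
    fourierWalsh (coordDeriv i g) S = if i ∈ S then fourierWalsh g S else 0 := by
  have h := expect_flip i fun x => g (flip i x) * walsh S x
  simp only [flip_flip] at h
  have h2 : fourierWalsh (coordDeriv i g) S =
      (𝔼 x, g x * walsh S x - 𝔼 x, g (flip i x) * walsh S x) / 2 := by
    rw [fourierWalsh_eq, ← Finset.expect_sub_distrib, Finset.expect_div]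
    exact Finset.expect_congr rfl fun x _ => by rw [coordDeriv]; ring
  rw [h2, ← h, fourierWalsh_eq]
  split_ifs with hi
  · simp only [walsh_flip_of_mem hi, mul_neg, Finset.expect_neg_distrib]; ring
  · simp only [walsh_flip_of_notMem hi]; ring

lemma HasDegLE.coordDeriv {d : ℕ} {g : Cube n → ℝ} (hg : HasDegLE d g) (i : Fin n) :
    HasDegLE d (coordDeriv i g) := fun S hS => by
  rw [fourierWalsh_coordDeriv, hg S hS, ite_self]

lemma influence_eq (g : Cube n → ℝ) (i : Fin n) : influence g i = 𝔼 x, coordDeriv i g x ^ 2 := by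
  rw [parseval, influence, Finset.sum_filter]
  refine Finset.sum_congr rfl fun S _ => ?_
  rw [fourierWalsh_coordDeriv]
  split_ifs <;> simp

lemma influence_nonneg (g : Cube n → ℝ) (i : Fin n) : 0 ≤ influence g i :=
  Finset.sum_nonneg fun _ _ => sq_nonneg _

lemma totalInfluence_nonneg (g : Cube n → ℝ) : 0 ≤ totalInfluence g :=
  Finset.sum_nonneg fun i _ => influence_nonneg g i

lemma totalInfluence_eq (g : Cube n → ℝ) :
    totalInfluence g = ∑ S, (S.card : ℝ) * fourierWalsh g S ^ 2 := by
  simp only [totalInfluence, influence, Finset.sum_filter]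
  rw [Finset.sum_comm]
  refine Finset.sum_congr rfl fun S _ => ?_
  rw [← Finset.sum_filter]
  simp

lemma expect_sub_mean_sq (g : Cube n → ℝ) :
    𝔼 x, (g x - 𝔼 y, g y) ^ 2 = 𝔼 x, g x ^ 2 - (𝔼 x, g x) ^ 2 := by
  simp only [sub_sq]
  rw [Finset.expect_add_distrib, Finset.expect_sub_distrib, ← Finset.expect_mul,
    ← Finset.mul_expect, Fintype.expect_const]
  ring

lemma variance_le_totalInfluence (g : Cube n → ℝ) :
    𝔼 x, (g x - 𝔼 y, g y) ^ 2 ≤ totalInfluence g := by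
  rw [expect_sub_mean_sq, parseval, ← fourierWalsh_empty, totalInfluence_eq,
    ← Finset.add_sum_erase _ _ (Finset.mem_univ (∅ : Finset (Fin n))), add_sub_cancel_left,
    ← Finset.add_sum_erase _ (fun S : Finset (Fin n) => (S.card : ℝ) * _)
      (Finset.mem_univ (∅ : Finset (Fin n)))]
  simp only [Finset.card_empty, Nat.cast_zero, zero_mul, zero_add]
  refine Finset.sum_le_sum fun S hS => le_mul_of_one_le_left (sq_nonneg _) ?_
  exact_mod_cast Finset.card_pos.mpr (Finset.nonempty_iff_ne_empty.mpr (Finset.ne_of_mem_erase hS))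

lemma HasDegLE.totalInfluence_le {d : ℕ} {g : Cube n → ℝ} (hg : HasDegLE d g) :
    totalInfluence g ≤ d * 𝔼 x, g x ^ 2 := by
  rw [parseval, totalInfluence_eq, Finset.mul_sum]
  refine Finset.sum_le_sum fun S _ => ?_
  rcases le_or_gt S.card d with hS | hS
  · gcongr
  · simp [hg S hS]

/-! ### Restrictions -/

/-- The restriction of `g` in which the coordinates in `H` are fixed to those of `ρ`. -/
def restrict (H : Finset (Fin n)) (ρ : Cube n) {α : Type*} (g : Cube n → α) : Cube n → α :=
  fun x => g (H.piecewise ρ x)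

/-- Exchanging the coordinates in `H` of two points of the cube. -/
def exchange (H : Finset (Fin n)) : Cube n × Cube n ≃ Cube n × Cube n :=
  Function.Involutive.toPerm (fun p => (H.piecewise p.1 p.2, H.piecewise p.2 p.1)) fun p => by
    ext i <;> by_cases hi : i ∈ H <;> simp [hi]

/-- Exchanging the H-coordinates of two independent uniform points preserves their joint law. -/
lemma expect_restrict (H : Finset (Fin n)) (F : Cube n → ℝ) :
    𝔼 ρ, 𝔼 x, restrict H ρ F x = 𝔼 x, F x := by
  have h : 𝔼 p : Cube n × Cube n, F (H.piecewise p.1 p.2) = 𝔼 p : Cube n × Cube n, F p.1 :=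
    Fintype.expect_equiv (exchange H) _ _ fun _ => rfl
  rw [← Finset.univ_product_univ, Finset.expect_product, Finset.expect_product] at h
  simpa [restrict] using h

lemma walsh_piecewise (H S : Finset (Fin n)) (ρ x : Cube n) :
    walsh S (H.piecewise ρ x) = walsh (S ∩ H) ρ * walsh (S \ H) x := by
  rw [← Finset.sdiff_union_inter S H, walsh_union (Finset.disjoint_sdiff_inter S H), mul_comm,
    Finset.sdiff_union_inter]
  congr 1
  · exact Finset.prod_congr rfl fun i hi => by
      rw [Finset.piecewise_eq_of_mem _ _ _ (Finset.mem_inter.mp hi).2]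
  · exact Finset.prod_congr rfl fun i hi => by
      rw [Finset.piecewise_eq_of_notMem _ _ _ (Finset.mem_sdiff.mp hi).2]

lemma HasDegLE.restrict {d : ℕ} {g : Cube n → ℝ} (hg : HasDegLE d g) (H : Finset (Fin n))
    (ρ : Cube n) : HasDegLE d (restrict H ρ g) := by
  intro T hT
  have : ∀ x, PTF.restrict H ρ g x * walsh T x =
      ∑ S, fourierWalsh g S * walsh (S ∩ H) ρ * (walsh (S \ H) x * walsh T x) := fun x => by
    rw [PTF.restrict, fourier_expansion g, Finset.sum_mul]
    exact Finset.sum_congr rfl fun S _ => by rw [walsh_piecewise]; ring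
  rw [fourierWalsh_eq]
  simp only [this]
  rw [Finset.expect_sum_comm]
  refine Finset.sum_eq_zero fun S _ => ?_
  rw [← Finset.mul_expect, expect_walsh_mul]
  split_ifs with h
  · rw [hg S (hT.trans_le (h ▸ Finset.card_le_card Finset.sdiff_subset)), zero_mul, zero_mul]
  · simp

lemma piecewise_flip_of_mem {H : Finset (Fin n)} {i : Fin n} (hi : i ∈ H) (ρ x : Cube n) :
    H.piecewise ρ (flip i x) = H.piecewise ρ x := by
  ext j
  by_cases hj : j ∈ H
  · simp [hj]
  · simp [hj, flip_of_ne (show j ≠ i by rintro rfl; exact hj hi)]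

lemma piecewise_flip_of_notMem {H : Finset (Fin n)} {i : Fin n} (hi : i ∉ H) (ρ x : Cube n) :
    H.piecewise ρ (flip i x) = flip i (H.piecewise ρ x) := by
  ext j
  rcases eq_or_ne j i with rfl | hj
  · simp [hi, flip_same]
  · rw [flip_of_ne hj]
    by_cases hjH : j ∈ H <;> simp [hjH, flip_of_ne hj]

lemma influence_restrict_of_mem {H : Finset (Fin n)} {i : Fin n} (hi : i ∈ H) (ρ : Cube n)
    (g : Cube n → ℝ) : influence (restrict H ρ g) i = 0 := by
  rw [influence_eq]
  simp [coordDeriv, restrict, piecewise_flip_of_mem hi]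

lemma influence_restrict_of_notMem {H : Finset (Fin n)} {i : Fin n} (hi : i ∉ H) (ρ : Cube n)
    (g : Cube n → ℝ) :
    influence (restrict H ρ g) i = 𝔼 x, restrict H ρ (fun y => coordDeriv i g y ^ 2) x := by
  rw [influence_eq]
  simp [coordDeriv, restrict, piecewise_flip_of_notMem hi]

lemma expect_influence_restrict {H : Finset (Fin n)} {i : Fin n} (hi : i ∉ H) (g : Cube n → ℝ) :
    𝔼 ρ, influence (restrict H ρ g) i = influence g i := by
  simp only [influence_restrict_of_notMem hi]
  rw [expect_restrict, influence_eq]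

lemma expect_pow_le_expect_pow {ι : Type*} [Fintype ι] [Nonempty ι] (q : ℕ) {X : ι → ℝ}
    (hX : ∀ i, 0 ≤ X i) : (𝔼 i, X i) ^ q ≤ 𝔼 i, X i ^ q := by
  have hc : (Fintype.card ι : ℝ) ≠ 0 := by exact_mod_cast Fintype.card_ne_zero
  have h := Real.pow_arith_mean_le_arith_mean_pow Finset.univ
    (fun _ => (Fintype.card ι : ℝ)⁻¹) X (fun _ _ => by positivity) (by simp) (fun i _ => hX i) q
  rw [← Finset.mul_sum, ← Finset.mul_sum] at h
  rwa [Fintype.expect_eq_sum_div_card, Fintype.expect_eq_sum_div_card, div_eq_inv_mul,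
    div_eq_inv_mul]

/-- A restricted influence is a conditional mean of the squared derivative. Jensen moves the power
inside the mean, and hypercontractivity applies to the derivative, again of degree at most d. -/
lemma expect_influence_restrict_pow_le {d q : ℕ} (hq : q ≠ 0) {g : Cube n → ℝ}
    (hg : HasDegLE d g) {H : Finset (Fin n)} {i : Fin n} (hi : i ∉ H) :
    𝔼 ρ, influence (restrict H ρ g) i ^ q ≤ ((2 * q - 1 : ℝ) ^ d * influence g i) ^ q := by
  calc 𝔼 ρ, influence (restrict H ρ g) i ^ q
      ≤ 𝔼 ρ, 𝔼 x, restrict H ρ (fun y => (coordDeriv i g y ^ 2) ^ q) x := by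
        refine Finset.expect_le_expect fun ρ _ => ?_
        rw [influence_restrict_of_notMem hi]
        have h0 : ∀ x, 0 ≤ restrict H ρ (fun y => coordDeriv i g y ^ 2) x := fun x => sq_nonneg _
        exact expect_pow_le_expect_pow q h0
    _ = 𝔼 x, (coordDeriv i g x ^ 2) ^ q :=
        expect_restrict H fun y => (coordDeriv i g y ^ 2) ^ q
    _ ≤ _ := by
        rw [influence_eq]
        exact hypercontractive hq (hg.coordDeriv i)

/-! ### Polynomials and Fourier degree -/

lemma signVal_pow (u : ℤˣ) (k : ℕ) : signVal u ^ k = if Odd k then signVal u else 1 := by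
  rcases Int.units_eq_one_or u with rfl | rfl
  · simp [signVal]
  · rcases Nat.even_or_odd k with h | h
    · simp [signVal, h.neg_one_pow, Nat.not_odd_iff_even.mpr h]
    · simp [signVal, h.neg_one_pow, h]

/-- Since x_i² = 1, a monomial equals on the cube the Walsh function of its odd exponents. -/
lemma hasDegLE_evalCube {d : ℕ} {p : MvPolynomial (Fin n) ℝ} (hp : p.totalDegree ≤ d) :
    HasDegLE d (evalCube p) := by
  intro T hT
  have h : ∀ x, evalCube p x * walsh T x = ∑ m ∈ p.support,
      p.coeff m * (walsh {i | Odd (m i)} x * walsh T x) := fun x => by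
    rw [evalCube, MvPolynomial.eval_eq', Finset.sum_mul]
    refine Finset.sum_congr rfl fun m _ => ?_
    simp only [signVal_pow, walsh, Finset.prod_filter]
    ring
  rw [fourierWalsh_eq]
  simp only [h]
  rw [Finset.expect_sum_comm]
  refine Finset.sum_eq_zero fun m hm => ?_
  rw [← Finset.mul_expect, expect_walsh_mul, if_neg, mul_zero]
  rintro rfl
  have h1 := MvPolynomial.le_totalDegree hm
  rw [Finsupp.sum_fintype _ _ fun _ => rfl] at h1
  have h2 : ({i | Odd (m i)} : Finset (Fin n)).card ≤ ∑ i, m i := by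
    rw [Finset.card_filter]
    refine Finset.sum_le_sum fun i _ => ?_
    split_ifs with h
    · exact h.pos
    · exact Nat.zero_le _
  omega

lemma HasDegLE.exists_evalCube {d : ℕ} {g : Cube n → ℝ} (hg : HasDegLE d g) :
    ∃ p : MvPolynomial (Fin n) ℝ, p.totalDegree ≤ d ∧ evalCube p = g := by
  refine ⟨∑ S with S.card ≤ d, MvPolynomial.C (fourierWalsh g S) * ∏ i ∈ S, MvPolynomial.X i,
    ?_, ?_⟩
  · refine MvPolynomial.totalDegree_finsetSum_le fun S hS => ?_
    refine (MvPolynomial.totalDegree_mul _ _).trans ?_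
    rw [MvPolynomial.totalDegree_C, zero_add]
    refine (MvPolynomial.totalDegree_finsetProd _ _).trans ?_
    simpa using hS
  · funext x
    rw [fourier_expansion g x, evalCube, map_sum, Finset.sum_filter]
    refine Finset.sum_congr rfl fun S _ => ?_
    split_ifs with hS
    · simp [walsh]
    · rw [hg S (not_le.mp hS), zero_mul]

/-! ### Limited independence -/

lemma expect_eq_card_mul (D : PMF (Cube n)) (g : Cube n → ℝ) :
    expect D g = Fintype.card (Cube n) * 𝔼 x, (D x).toReal * g x := by
  rw [Fintype.card_mul_expect, expect]

lemma sum_toReal (D : PMF (Cube n)) : ∑ x, (D x).toReal = 1 := by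
  rw [← ENNReal.toReal_sum fun x _ => D.apply_ne_top x, ← tsum_fintype (L := .unconditional _),
    D.tsum_coe, ENNReal.toReal_one]

lemma sum_map_toReal {α : Type*} [Fintype α] (D : PMF (Cube n)) (r : Cube n → α) (G : α → ℝ) :
    ∑ a, (D.map r a).toReal * G a = expect D fun x => G (r x) := by
  classical
  have h : ∀ a, (D.map r a).toReal = ∑ x, if a = r x then (D x).toReal else 0 := fun a => by
    rw [PMF.map_apply, tsum_fintype, ENNReal.toReal_sum]
    · exact Finset.sum_congr rfl fun x _ => by split_ifs <;> simp
    · intro x _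
      split_ifs
      · exact D.apply_ne_top x
      · simp
  simp only [h, Finset.sum_mul, expect]
  rw [Finset.sum_comm]
  refine Finset.sum_congr rfl fun x _ => ?_
  simp

lemma expect_walsh_eq_zero {k : ℕ} {D : PMF (Cube n)} (hD : IsKWiseIndependent k D)
    {S : Finset (Fin n)} (hS : S ≠ ∅) (hk : S.card ≤ k) : expect D (walsh S) = 0 := by
  have h := sum_map_toReal D (fun (x : Cube n) (i : S) => x i) fun σ => ∏ i, signVal (σ i)
  have h2 : (fun x : Cube n => ∏ i : S, signVal (x i)) = walsh S :=
    funext fun x => Finset.prod_coe_sort S fun i => signVal (x i)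
  rw [hD S hk] at h
  rw [← h2, ← h]
  simp only [PMF.uniformOfFintype_apply, ← Finset.mul_sum]
  rw [← Fintype.piFinset_univ, Finset.sum_prod_piFinset, mul_eq_zero]
  right
  obtain ⟨a, ha⟩ := Finset.nonempty_iff_ne_empty.mpr hS
  exact Finset.prod_eq_zero (Finset.mem_univ ⟨a, ha⟩) (by simp [signVal])

lemma isKWiseIndependent_of_expect_walsh {k : ℕ} {D : PMF (Cube n)}
    (h : ∀ S : Finset (Fin n), S ≠ ∅ → S.card ≤ k → expect D (walsh S) = 0) :
    IsKWiseIndependent k D := by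
  classical
  intro S hS
  ext σ
  set y : Cube n := fun i => if hi : i ∈ S then σ ⟨i, hi⟩ else 1 with hy
  have hyσ : ∀ i : S, y i = σ i := fun i => by simp [hy]
  rw [← ENNReal.toReal_eq_toReal_iff' (PMF.apply_ne_top _ _) (PMF.apply_ne_top _ _)]
  have h1 := sum_map_toReal D (fun (x : Cube n) (i : S) => x i)
    fun τ => if τ = σ then (1 : ℝ) else 0
  simp only [mul_ite, mul_one, mul_zero, Finset.sum_ite_eq', Finset.mem_univ, if_true] at h1
  -- The indicator of a subcube is a combination of Walsh functions on subsets of S, of which only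
  -- the constant one has nonzero mean under D.
  have h2 : ∀ x : Cube n, (if (fun i : S => x i) = σ then (1 : ℝ) else 0) =
      (2 ^ S.card)⁻¹ * ∑ T ∈ S.powerset, walsh T y * walsh T x := by
    intro x
    have e : ∑ T ∈ S.powerset, walsh T y * walsh T x =
        ∏ i ∈ S, (1 + signVal (y i) * signVal (x i)) := by
      rw [Finset.prod_one_add]
      exact Finset.sum_congr rfl fun T _ => Finset.prod_mul_distrib.symm
    rw [e]
    split_ifs with hx
    · have : ∀ i ∈ S, 1 + signVal (y i) * signVal (x i) = 2 := fun i hi => by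
        rw [hyσ ⟨i, hi⟩, ← hx, signVal_mul_self]; norm_num
      rw [Finset.prod_congr rfl this, Finset.prod_const, inv_mul_cancel₀ (by positivity)]
    · obtain ⟨i, hi⟩ := Function.ne_iff.mp hx
      rw [Finset.prod_eq_zero i.2, mul_zero]
      rw [hyσ i, ← neg_eq_iff_eq_neg.mpr (Int.units_ne_iff_eq_neg.mp hi), signVal_neg]
      linear_combination -signVal_mul_self (x i)
  have h3 : expect D (fun x => ∑ T ∈ S.powerset, walsh T y * walsh T x) = 1 := by
    have : expect D (fun x => ∑ T ∈ S.powerset, walsh T y * walsh T x) =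
        ∑ T ∈ S.powerset, walsh T y * expect D (walsh T) := by
      simp only [expect, Finset.mul_sum]
      rw [Finset.sum_comm]
      exact Finset.sum_congr rfl fun T _ => Finset.sum_congr rfl fun x _ => by ring
    rw [this, Finset.sum_eq_single_of_mem ∅ (Finset.empty_mem_powerset S)]
    · simp [walsh_empty, expect, sum_toReal]
    · intro T hT hne
      rw [h T hne ((Finset.card_le_card (Finset.mem_powerset.mp hT)).trans hS), mul_zero]
  rw [h1]
  simp only [h2]
  have h4 : expect D (fun x => ((2 : ℝ) ^ S.card)⁻¹ * ∑ T ∈ S.powerset, walsh T y * walsh T x) =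
      (2 ^ S.card)⁻¹ := by
    refine Eq.trans ?_ (mul_one _)
    rw [← h3, expect, expect, Finset.mul_sum]
    exact Finset.sum_congr rfl fun x _ => mul_left_comm _ _ _
  rw [h4]
  simp [PMF.uniformOfFintype_apply, Fintype.card_units_int]

lemma _root_.IsKWiseIndependent.mono {k l : ℕ} {D : PMF (Cube n)} (hD : IsKWiseIndependent l D)
    (h : k ≤ l) : IsKWiseIndependent k D := fun S hS => hD S (hS.trans h)

/-- Only the sets S with S \ H = T contribute, and these have at most |T| + |H| elements. It is
applied to the probability mass function of D. -/
lemma fourierWalsh_restrict {k : ℕ} {w : Cube n → ℝ}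
    (hw : ∀ S : Finset (Fin n), S ≠ ∅ → S.card ≤ k → fourierWalsh w S = 0)
    {H T : Finset (Fin n)} (hk : T.card + H.card ≤ k) (ρ : Cube n) :
    fourierWalsh (restrict H ρ w) T = if T = ∅ then fourierWalsh w ∅ else 0 := by
  have : ∀ x, restrict H ρ w x * walsh T x =
      ∑ S, fourierWalsh w S * walsh (S ∩ H) ρ * (walsh (S \ H) x * walsh T x) := fun x => by
    rw [restrict, fourier_expansion w, Finset.sum_mul]
    exact Finset.sum_congr rfl fun S _ => by rw [walsh_piecewise]; ring
  rw [fourierWalsh_eq]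
  simp only [this]
  rw [Finset.expect_sum_comm]
  simp only [← Finset.mul_expect, expect_walsh_mul]
  rw [Finset.sum_eq_single_of_mem ∅ (Finset.mem_univ _)]
  · simp [walsh_empty, eq_comm]
  · intro S _ hS
    split_ifs with h
    · rw [hw S hS, zero_mul, zero_mul]
      refine le_trans ?_ hk
      rw [← h, Finset.card_sdiff_add_card]
      exact Finset.card_le_card Finset.subset_union_left
    · rw [mul_zero]

/-- Fixing few coordinates of a distribution of limited independence and drawing them afresh leaves
a distribution of limited independence. -/
lemma exists_restricted {k : ℕ} {D : PMF (Cube n)} {H : Finset (Fin n)}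
    (hD : IsKWiseIndependent (k + H.card) D) (ρ : Cube n) :
    ∃ D' : PMF (Cube n), IsKWiseIndependent k D' ∧ ∀ x, D' x = D (H.piecewise ρ x) := by
  have hc : (Fintype.card (Cube n) : ℝ) ≠ 0 := by exact_mod_cast Fintype.card_ne_zero
  have hf : ∀ S, expect D (walsh S) =
      Fintype.card (Cube n) * fourierWalsh (fun x => (D x).toReal) S := fun S => by
    rw [expect_eq_card_mul, fourierWalsh_eq]
  have hw : ∀ S : Finset (Fin n), S ≠ ∅ → S.card ≤ k + H.card →
      fourierWalsh (fun x => (D x).toReal) S = 0 := fun S hS hk => by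
    have := hf S
    rw [expect_walsh_eq_zero hD hS hk] at this
    exact (mul_eq_zero.mp this.symm).resolve_left hc
  have key : ∀ T : Finset (Fin n), T.card ≤ k →
      ∑ x, (D (H.piecewise ρ x)).toReal * walsh T x = if T = ∅ then 1 else 0 := fun T hT => by
    have h := fourierWalsh_restrict hw (Nat.add_le_add_right hT H.card) ρ
    have h0 : (Fintype.card (Cube n) : ℝ) * fourierWalsh (fun x => (D x).toReal) ∅ = 1 := by
      rw [← hf, ← sum_toReal D]; simp [expect, walsh_empty]
    rw [← Fintype.card_mul_expect, ← fourierWalsh_eq (fun x => (D (H.piecewise ρ x)).toReal)]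
    change (Fintype.card (Cube n) : ℝ) * fourierWalsh (restrict H ρ fun x => (D x).toReal) T = _
    rw [h]
    split_ifs
    · exact h0
    · simp
  -- The case T = ∅. No normalising factor is needed: the H-marginal of D is uniform, and summing
  -- over the redrawn coordinates supplies the factor 2^|H|.
  have hsum : ∑ x, D (H.piecewise ρ x) = 1 := by
    have h := key ∅ (Nat.zero_le _)
    simp only [walsh_empty, mul_one, if_true] at h
    rw [← ENNReal.toReal_sum fun x _ => D.apply_ne_top _] at h
    exact (ENNReal.toReal_eq_one_iff _).mp h
  refine ⟨PMF.ofFintype _ hsum, isKWiseIndependent_of_expect_walsh fun S hS hk => ?_, fun x => rfl⟩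
  have := key S hk
  rwa [if_neg hS] at this

/-- The square only involves Walsh functions of sets S ∆ T with at most 2d elements. -/
lemma expect_sq_eq {d : ℕ} {D : PMF (Cube n)} (hD : IsKWiseIndependent (2 * d) D)
    {g : Cube n → ℝ} (hg : HasDegLE d g) : expect D (fun x => g x ^ 2) = 𝔼 x, g x ^ 2 := by
  have hx : ∀ x, g x ^ 2 = ∑ S, ∑ T, fourierWalsh g S * fourierWalsh g T * walsh (S ∆ T) x :=
    fun x => by
      rw [pow_two, fourier_expansion g x, Finset.sum_mul_sum]
      exact Finset.sum_congr rfl fun S _ => Finset.sum_congr rfl fun T _ => by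
        rw [← walsh_mul]; ring
  have hE : expect D (fun x => g x ^ 2) =
      ∑ S, ∑ T, fourierWalsh g S * fourierWalsh g T * expect D (walsh (S ∆ T)) := by
    simp only [hx, expect, Finset.mul_sum]
    rw [Finset.sum_comm]
    refine Finset.sum_congr rfl fun S _ => ?_
    rw [Finset.sum_comm]
    exact Finset.sum_congr rfl fun T _ => Finset.sum_congr rfl fun x _ => by ring
  rw [hE, parseval]
  refine Finset.sum_congr rfl fun S _ => ?_
  rw [Finset.sum_eq_single_of_mem S (Finset.mem_univ S)]
  · simp [expect, walsh_empty, sum_toReal, pow_two]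
  · intro T _ hT
    by_cases hS : d < S.card
    · simp [hg S hS]
    by_cases hT' : d < T.card
    · simp [hg T hT']
    rw [expect_walsh_eq_zero hD, mul_zero]
    · rw [← Finset.bot_eq_empty, ne_eq, symmDiff_eq_bot]
      exact fun h => hT h.symm
    · have h1 : (S ∆ T).card ≤ (S ∪ T).card :=
        Finset.card_le_card (symmDiff_le_sup (a := S) (b := T))
      have h2 := Finset.card_union_le S T
      omega

/-- A low-degree function whose mean dominates its standard deviation has nearly constant sign
under a distribution of limited independence. -/
lemma abs_expect_sgn_sub_le {d : ℕ} {D : PMF (Cube n)} (hD : IsKWiseIndependent (2 * d) D)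
    {g : Cube n → ℝ} (hg : HasDegLE d g) (h0 : 𝔼 x, g x ≠ 0) :
    |expect D (fun x => signVal (sgn (g x))) - signVal (sgn (𝔼 x, g x))| ≤
      2 * (𝔼 x, (g x - 𝔼 y, g y) ^ 2) / (𝔼 x, g x) ^ 2 := by
  set h := 𝔼 x, g x with hh
  have hg' : HasDegLE d fun x => g x - h := by
    intro S hS
    rw [← hg S hS, fourierWalsh_eq, fourierWalsh_eq]
    simp only [sub_mul]
    rw [Finset.expect_sub_distrib, ← Finset.mul_expect, expect_walsh,
      if_neg (Finset.card_pos.mp (by omega)).ne_empty, mul_zero, sub_zero]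
  -- If t and h have different signs, then |t - h| ≥ |h|.
  have pt : ∀ t : ℝ, |signVal (sgn t) - signVal (sgn h)| ≤ 2 / h ^ 2 * (t - h) ^ 2 := by
    intro t
    have hpos : 0 < h ^ 2 := by positivity
    rw [div_mul_eq_mul_div, le_div_iff₀ hpos]
    unfold sgn
    split_ifs with ht hh' hh'
    · simp; positivity
    · simp only [signVal]; norm_num; nlinarith
    · simp only [signVal]; norm_num; nlinarith
    · simp; positivity
  have e1 : expect D (fun x => signVal (sgn (g x))) - signVal (sgn h) =
      ∑ x, (D x).toReal * (signVal (sgn (g x)) - signVal (sgn h)) := by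
    simp only [mul_sub, Finset.sum_sub_distrib, ← Finset.sum_mul, sum_toReal, one_mul, expect]
  rw [e1]
  calc |∑ x, (D x).toReal * (signVal (sgn (g x)) - signVal (sgn h))|
      ≤ ∑ x, |(D x).toReal * (signVal (sgn (g x)) - signVal (sgn h))| :=
        Finset.abs_sum_le_sum_abs _ _
    _ ≤ ∑ x, 2 / h ^ 2 * ((D x).toReal * (g x - h) ^ 2) := by
        refine Finset.sum_le_sum fun x _ => ?_
        rw [abs_mul, abs_of_nonneg ENNReal.toReal_nonneg, mul_left_comm]
        exact mul_le_mul_of_nonneg_left (pt _) ENNReal.toReal_nonneg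
    _ = 2 / h ^ 2 * expect D (fun x => (g x - h) ^ 2) := by rw [← Finset.mul_sum, expect]
    _ = _ := by rw [expect_sq_eq hD hg']; ring

/-! ### Probabilities over finite types -/

open Classical in
/-- The probability of `P` under the uniform distribution. -/
noncomputable def prob {ι : Type*} [Fintype ι] (P : ι → Prop) : ℝ := 𝔼 i, if P i then 1 else 0

section prob

variable {ι : Type*} [Fintype ι]

lemma prob_le_add {P Q R : ι → Prop} (h : ∀ i, P i → Q i ∨ R i) : prob P ≤ prob Q + prob R := by
  unfold prob
  rw [← Finset.expect_add_distrib]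
  refine Finset.expect_le_expect fun i _ => ?_
  have := h i
  by_cases hP : P i <;> by_cases hQ : Q i <;> by_cases hR : R i <;> simp_all

lemma prob_eq_one [Nonempty ι] {P : ι → Prop} (h : ∀ i, P i) : prob P = 1 := by
  simp [prob, h]

lemma prob_mul_le {X : ι → ℝ} (hX : ∀ i, 0 ≤ X i) (a : ℝ) :
    prob (fun i => a ≤ X i) * a ≤ 𝔼 i, X i := by
  rw [prob, Finset.expect_mul]
  refine Finset.expect_le_expect fun i _ => ?_
  split_ifs with h
  · simpa using h
  · simpa using hX i

/-- The Paley-Zygmund inequality. -/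
lemma expect_sq_le_mul_prob [Nonempty ι] (X : ι → ℝ) (h0 : 0 ≤ 𝔼 i, X i) :
    (𝔼 i, X i) ^ 2 ≤ 4 * (𝔼 i, X i ^ 2) * prob fun i => (𝔼 j, X j) / 2 ≤ X i := by
  classical
  set μ := 𝔼 i, X i with hμ
  -- Values below μ/2 contribute at most μ/2 to the mean; Cauchy-Schwarz handles the rest.
  have h1 : μ ≤ μ / 2 + 𝔼 i, X i * (if μ / 2 ≤ X i then 1 else 0) := by
    have hc : 𝔼 _i : ι, μ / 2 = μ / 2 := Fintype.expect_const _
    conv_lhs => rw [hμ]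
    conv_rhs => lhs; rw [← hc]
    rw [← Finset.expect_add_distrib]
    refine Finset.expect_le_expect fun i _ => ?_
    split_ifs with h
    · linarith
    · linarith [not_le.mp h]
  have h2 := Finset.expect_mul_sq_le_sq_mul_sq Finset.univ X
    fun i => if μ / 2 ≤ X i then (1 : ℝ) else 0
  have h3 : 𝔼 i, (if μ / 2 ≤ X i then (1 : ℝ) else 0) ^ 2 = prob fun i => μ / 2 ≤ X i :=
    Finset.expect_congr rfl fun i _ => by split_ifs <;> simp
  rw [h3] at h2
  have h4 : (μ / 2) ^ 2 ≤ (𝔼 i, X i * (if μ / 2 ≤ X i then 1 else 0)) ^ 2 :=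
    pow_le_pow_left₀ (by linarith) (by linarith) 2
  rw [mul_assoc]
  linarith

end prob

/-! ### Restricting the influential coordinates -/

/-- Greedy choice: a coordinate violating the first alternative carries more than a fraction t of
the remaining weight, so moving it into H shrinks that weight by 1 - t. -/
lemma exists_critical_set (w : Fin n → ℝ) {t : ℝ} (ht : t ≤ 1) (m : ℕ) :
    ∃ H : Finset (Fin n), H.card ≤ m ∧
      ((∀ i ∉ H, w i ≤ t * ∑ j ∈ Hᶜ, w j) ∨ ∑ j ∈ Hᶜ, w j ≤ (1 - t) ^ m * ∑ j, w j) := by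
  induction m with
  | zero => exact ⟨∅, by simp, Or.inr (by simp)⟩
  | succ m ih =>
    obtain ⟨H, hH, h | h⟩ := ih
    · exact ⟨H, by omega, Or.inl h⟩
    by_cases hc : ∀ i ∉ H, w i ≤ t * ∑ j ∈ Hᶜ, w j
    · exact ⟨H, by omega, Or.inl hc⟩
    push Not at hc
    obtain ⟨i, hi, hlt⟩ := hc
    refine ⟨insert i H, (Finset.card_insert_le i H).trans (by omega), Or.inr ?_⟩
    have hsum := Finset.add_sum_erase Hᶜ w (Finset.mem_compl.mpr hi)
    rw [← Finset.compl_insert] at hsum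
    calc ∑ j ∈ (insert i H)ᶜ, w j ≤ (1 - t) * ∑ j ∈ Hᶜ, w j := by linarith
      _ ≤ (1 - t) * ((1 - t) ^ m * ∑ j, w j) := mul_le_mul_of_nonneg_left h (by linarith)
      _ = _ := by ring

lemma totalInfluence_restrict (H : Finset (Fin n)) (ρ : Cube n) (g : Cube n → ℝ) :
    totalInfluence (restrict H ρ g) = ∑ i ∈ Hᶜ, influence (restrict H ρ g) i := by
  rw [totalInfluence, ← Finset.sum_compl_add_sum H, add_eq_left]
  exact Finset.sum_eq_zero fun i hi => influence_restrict_of_mem hi ρ g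

lemma expect_totalInfluence_restrict (H : Finset (Fin n)) (g : Cube n → ℝ) :
    𝔼 ρ, totalInfluence (restrict H ρ g) = ∑ i ∈ Hᶜ, influence g i := by
  simp only [totalInfluence_restrict]
  rw [Finset.expect_sum_comm]
  exact Finset.sum_congr rfl fun i hi => expect_influence_restrict (Finset.mem_compl.mp hi) g

/-- Cauchy-Schwarz bounds each product of two influences by their second moments. This is the
second-moment input to Paley-Zygmund. -/
lemma expect_totalInfluence_restrict_sq_le {d : ℕ} {g : Cube n → ℝ} (hg : HasDegLE d g)
    (H : Finset (Fin n)) :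
    𝔼 ρ, totalInfluence (restrict H ρ g) ^ 2 ≤ 9 ^ d * (∑ i ∈ Hᶜ, influence g i) ^ 2 := by
  simp only [totalInfluence_restrict, pow_two (∑ i ∈ Hᶜ, _), Finset.sum_mul_sum]
  rw [Finset.expect_sum_comm, Finset.mul_sum]
  refine Finset.sum_le_sum fun i hi => ?_
  rw [Finset.expect_sum_comm, Finset.mul_sum]
  refine Finset.sum_le_sum fun j hj => ?_
  have h3 : (2 * (2 : ℕ) - 1 : ℝ) = 3 := by norm_num
  have bi := expect_influence_restrict_pow_le two_ne_zero hg (Finset.mem_compl.mp hi)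
  have bj := expect_influence_restrict_pow_le two_ne_zero hg (Finset.mem_compl.mp hj)
  rw [h3] at bi bj
  have hcs := Finset.expect_mul_sq_le_sq_mul_sq Finset.univ
    (fun ρ => influence (restrict H ρ g) i) fun ρ => influence (restrict H ρ g) j
  have h9 : (9 : ℝ) ^ d = 3 ^ d * 3 ^ d := by rw [← mul_pow]; norm_num
  refine le_of_sq_le_sq (hcs.trans ?_) ?_
  · calc _ ≤ (3 ^ d * influence g i) ^ 2 * (3 ^ d * influence g j) ^ 2 :=
          mul_le_mul bi bj (Finset.expect_nonneg fun _ _ => sq_nonneg _) (sq_nonneg _)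
      _ = _ := by rw [h9]; ring
  · exact mul_nonneg (by positivity) (mul_nonneg (influence_nonneg g i) (influence_nonneg g j))

/-- If no coordinate outside `H` dominates the influence of `g` outside `H`, then a random
restriction of `H` leaves a regular function with substantial probability. -/
lemma le_prob_isTauRegular {d q : ℕ} (hq : q ≠ 0) {g : Cube n → ℝ} (hg : HasDegLE d g)
    {H : Finset (Fin n)} {τ t : ℝ} (hτ : 0 < τ)
    (hH : ∀ i ∉ H, influence g i ≤ t * ∑ j ∈ Hᶜ, influence g j)
    (hqt : ((2 * q - 1 : ℝ) ^ d) ^ q * t ^ (q - 1) ≤ (τ / 2) ^ q / (8 * 9 ^ d)) :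
    1 / (8 * 9 ^ d) ≤ prob fun ρ => IsTauRegular τ (restrict H ρ g) := by
  set I := ∑ j ∈ Hᶜ, influence g j with hI
  have hI0 : 0 ≤ I := Finset.sum_nonneg fun i _ => influence_nonneg g i
  have h9 : (1 : ℝ) ≤ 9 ^ d := one_le_pow₀ (by norm_num)
  rcases hI0.eq_or_lt with h0 | hpos
  · have hreg : ∀ ρ, IsTauRegular τ (restrict H ρ g) := by
      intro ρ i
      have hnn := mul_nonneg hτ.le (totalInfluence_nonneg (restrict H ρ g))
      by_cases hi : i ∈ H
      · rwa [influence_restrict_of_mem hi]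
      · have h1 : 𝔼 ρ, influence (restrict H ρ g) i = 0 := by
          rw [expect_influence_restrict hi]
          refine le_antisymm ((hH i hi).trans ?_) (influence_nonneg g i)
          rw [← h0, mul_zero]
        have h2 := (Fintype.expect_eq_zero_iff_of_nonneg
          (fun ρ => influence_nonneg (restrict H ρ g) i)).mp h1
        rwa [show influence (restrict H ρ g) i = 0 from congrFun h2 ρ]
    rw [prob_eq_one hreg, div_le_one (by positivity)]
    linarith
  have hq1 : (1 : ℝ) ≤ q := by exact_mod_cast Nat.one_le_iff_ne_zero.mpr hq
  have hB : (0 : ℝ) ≤ (2 * q - 1 : ℝ) ^ d := pow_nonneg (by linarith) d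
  have hmean := expect_totalInfluence_restrict H g
  have hpz := expect_sq_le_mul_prob (fun ρ => totalInfluence (restrict H ρ g))
    (by rw [hmean]; exact hI0)
  rw [hmean, ← hI] at hpz
  have hbig : 1 / (4 * 9 ^ d) ≤ prob fun ρ => I / 2 ≤ totalInfluence (restrict H ρ g) := by
    have h1 := expect_totalInfluence_restrict_sq_le hg H
    rw [← hI] at h1
    have hp : 0 ≤ prob fun ρ => I / 2 ≤ totalInfluence (restrict H ρ g) :=
      Finset.expect_nonneg fun _ _ => by split_ifs <;> norm_num
    have h2 : I ^ 2 * 1 ≤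
        I ^ 2 * (4 * 9 ^ d * prob fun ρ => I / 2 ≤ totalInfluence (restrict H ρ g)) := by
      calc I ^ 2 * 1 ≤ 4 * (9 ^ d * I ^ 2) * _ := by
            rw [mul_one]
            exact hpz.trans (mul_le_mul_of_nonneg_right (by linarith) hp)
        _ = _ := by ring
    have h3 := le_of_mul_le_mul_left h2 (by positivity)
    rw [div_le_iff₀ (by positivity)]
    linarith
  -- Markov is applied to the sum of the q-th powers. Since every influence outside H is at most
  -- t·I, that sum has mean of order t^(q-1)·I^q, with no factor n as a naive union bound would
  -- give.
  have hbad : (prob fun ρ => (τ * I / 2) ^ q ≤ ∑ i ∈ Hᶜ, influence (restrict H ρ g) i ^ q) ≤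
      1 / (8 * 9 ^ d) := by
    have h1 := prob_mul_le
      (X := fun ρ => ∑ i ∈ Hᶜ, influence (restrict H ρ g) i ^ q)
      (fun ρ => Finset.sum_nonneg fun i _ => pow_nonneg (influence_nonneg _ i) q)
      ((τ * I / 2) ^ q)
    have h2 : 𝔼 ρ, ∑ i ∈ Hᶜ, influence (restrict H ρ g) i ^ q ≤
        1 / (8 * 9 ^ d) * (τ * I / 2) ^ q := by
      obtain ⟨r, rfl⟩ := Nat.exists_eq_succ_of_ne_zero hq
      rw [Finset.expect_sum_comm]
      calc ∑ i ∈ Hᶜ, 𝔼 ρ, influence (restrict H ρ g) i ^ (r + 1)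
          ≤ ∑ i ∈ Hᶜ, ((2 * (r + 1 : ℕ) - 1 : ℝ) ^ d) ^ (r + 1) * (t * I) ^ r * influence g i := by
            refine Finset.sum_le_sum fun i hi => ?_
            refine (expect_influence_restrict_pow_le hq hg (Finset.mem_compl.mp hi)).trans ?_
            rw [mul_pow, pow_succ (influence g i), ← mul_assoc]
            have := pow_le_pow_left₀ (influence_nonneg g i) (hH i (Finset.mem_compl.mp hi)) r
            exact mul_le_mul_of_nonneg_right
              (mul_le_mul_of_nonneg_left this (pow_nonneg hB _)) (influence_nonneg g i)
        _ = ((2 * (r + 1 : ℕ) - 1 : ℝ) ^ d) ^ (r + 1) * t ^ r * I ^ (r + 1) := by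
            rw [← Finset.mul_sum, mul_pow, pow_succ I]; ring
        _ ≤ (τ / 2) ^ (r + 1) / (8 * 9 ^ d) * I ^ (r + 1) :=
            mul_le_mul_of_nonneg_right hqt (by positivity)
        _ = _ := by rw [Nat.succ_eq_add_one, mul_div_right_comm, mul_pow (τ / 2)]; ring
    exact le_of_mul_le_mul_right (h1.trans h2) (by positivity)
  have hcov := prob_le_add (P := fun ρ => I / 2 ≤ totalInfluence (restrict H ρ g))
    (Q := fun ρ => IsTauRegular τ (restrict H ρ g))
    (R := fun ρ => (τ * I / 2) ^ q ≤ ∑ i ∈ Hᶜ, influence (restrict H ρ g) i ^ q) (by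
      intro ρ hρ
      by_contra hcon
      push Not at hcon
      obtain ⟨h1, h2⟩ := hcon
      refine h1 fun i => ?_
      by_cases hi : i ∈ H
      · rw [influence_restrict_of_mem hi]
        exact mul_nonneg hτ.le (totalInfluence_nonneg _)
      by_contra hlt
      push Not at hlt
      refine h2.not_ge ?_
      refine le_trans ?_ (Finset.single_le_sum (f := fun i => influence (restrict H ρ g) i ^ q)
        (fun i _ => pow_nonneg (influence_nonneg _ i) q) (Finset.mem_compl.mpr hi))
      refine pow_le_pow_left₀ (by positivity) ?_ q
      have := mul_le_mul_of_nonneg_left hρ hτ.le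
      linarith)
  have : (1 : ℝ) / (4 * 9 ^ d) = 1 / (8 * 9 ^ d) + 1 / (8 * 9 ^ d) := by field_simp; norm_num
  linarith

/-- If the influence of `g` outside `H` is tiny, then a random restriction of `H` leaves a function
concentrated around its mean with substantial probability. -/
lemma le_prob_concentrated {d : ℕ} {g : Cube n → ℝ} (hg : HasDegLE d g) (hg0 : 0 < 𝔼 x, g x ^ 2)
    {H : Finset (Fin n)} {β δ : ℝ} (hδ0 : 0 < δ) (hδ : δ ≤ 1)
    (hH : ∑ j ∈ Hᶜ, influence g j ≤ β * 𝔼 x, g x ^ 2) (hβ : 512 * 9 ^ d * β ≤ δ) :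
    1 / (32 * 9 ^ d) ≤ prob fun ρ => 𝔼 x, restrict H ρ g x ≠ 0 ∧
      4 * 𝔼 x, (restrict H ρ g x - 𝔼 y, restrict H ρ g y) ^ 2 ≤
        δ * (𝔼 x, restrict H ρ g x) ^ 2 := by
  set E := 𝔼 x, g x ^ 2 with hE
  set h : Cube n → ℝ := fun ρ => 𝔼 x, restrict H ρ g x with hh
  set V : Cube n → ℝ := fun ρ => 𝔼 x, (restrict H ρ g x - h ρ) ^ 2 with hV
  have h9 : (1 : ℝ) ≤ 9 ^ d := one_le_pow₀ (by norm_num)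
  have hV0 : ∀ ρ, 0 ≤ V ρ := fun ρ => Finset.expect_nonneg fun _ _ => sq_nonneg _
  have hVE : 𝔼 ρ, V ρ ≤ β * E := by
    refine le_trans (Finset.expect_le_expect fun ρ _ =>
      variance_le_totalInfluence (restrict H ρ g)) ?_
    rwa [expect_totalInfluence_restrict]
  have hsq : ∀ ρ, h ρ ^ 2 = 𝔼 x, restrict H ρ (fun y => g y ^ 2) x - V ρ := fun ρ => by
    have := expect_sub_mean_sq (restrict H ρ g)
    simp only [hV, hh]
    rw [this]
    simp [restrict]
  have hmean : E / 2 ≤ 𝔼 ρ, h ρ ^ 2 := by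
    simp only [hsq]
    rw [Finset.expect_sub_distrib, expect_restrict H fun y => g y ^ 2]
    -- 512·9^d·β ≤ δ ≤ 1 makes β at most 1/2.
    have : β * E ≤ E / 2 := by
      rcases le_or_gt β 0 with hb | hb
      · nlinarith
      · nlinarith
    linarith
  have hfour : 𝔼 ρ, (h ρ ^ 2) ^ 2 ≤ 9 ^ d * E ^ 2 := by
    have h3 : (2 * (2 : ℕ) - 1 : ℝ) = 3 := by norm_num
    have hh9 : (9 : ℝ) ^ d = 3 ^ d * 3 ^ d := by rw [← mul_pow]; norm_num
    calc 𝔼 ρ, (h ρ ^ 2) ^ 2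
        ≤ 𝔼 ρ, 𝔼 x, restrict H ρ (fun y => (g y ^ 2) ^ 2) x := by
          refine Finset.expect_le_expect fun ρ _ => ?_
          have h0 : ∀ x, 0 ≤ restrict H ρ (fun y => g y ^ 2) x := fun x => sq_nonneg _
          refine le_trans ?_ (expect_pow_le_expect_pow 2 h0)
          refine pow_le_pow_left₀ (sq_nonneg _) ?_ 2
          have := hsq ρ
          have h1 := hV0 ρ
          simp only [restrict] at this ⊢
          linarith
      _ = 𝔼 x, (g x ^ 2) ^ 2 := expect_restrict H fun y => (g y ^ 2) ^ 2
      _ ≤ ((2 * (2 : ℕ) - 1 : ℝ) ^ d * E) ^ 2 := hypercontractive two_ne_zero hg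
      _ = _ := by rw [h3, hh9]; ring
  have hpz := expect_sq_le_mul_prob (fun ρ => h ρ ^ 2)
    (Finset.expect_nonneg fun _ _ => sq_nonneg _)
  set p := prob fun ρ => (𝔼 σ, h σ ^ 2) / 2 ≤ h ρ ^ 2 with hp
  have hp0 : 0 ≤ p := Finset.expect_nonneg fun _ _ => by split_ifs <;> norm_num
  have hbig : 1 / (16 * 9 ^ d) ≤ p := by
    have h2 : E ^ 2 * 1 ≤ E ^ 2 * (16 * 9 ^ d * p) := by
      have h4 : (E / 2) ^ 2 ≤ (𝔼 ρ, h ρ ^ 2) ^ 2 := pow_le_pow_left₀ (by positivity) hmean 2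
      have h5 := mul_le_mul_of_nonneg_right hfour hp0
      linarith
    have h3 := le_of_mul_le_mul_left h2 (by positivity)
    rw [div_le_iff₀ (by positivity)]
    linarith
  have hbad : (prob fun ρ => δ * E / 16 ≤ V ρ) ≤ 1 / (32 * 9 ^ d) := by
    have h1 := (prob_mul_le hV0 (δ * E / 16)).trans hVE
    refine le_of_mul_le_mul_right (h1.trans ?_) (show 0 < δ * E / 16 by positivity)
    rw [one_div_mul_eq_div, le_div_iff₀ (by positivity)]
    have := mul_le_mul_of_nonneg_right hβ hg0.le
    linarith
  have hcov := prob_le_add (P := fun ρ => (𝔼 σ, h σ ^ 2) / 2 ≤ h ρ ^ 2)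
    (Q := fun ρ => h ρ ≠ 0 ∧ 4 * V ρ ≤ δ * h ρ ^ 2) (R := fun ρ => δ * E / 16 ≤ V ρ) (by
      intro ρ hρ
      rw [or_iff_not_imp_right, not_le]
      intro hlt
      have h1 : E / 4 ≤ h ρ ^ 2 := by linarith
      refine ⟨fun h0 => ?_, ?_⟩
      · rw [h0] at h1; linarith
      · have := mul_le_mul_of_nonneg_left h1 hδ0.le
        linarith)
  have : (1 : ℝ) / (16 * 9 ^ d) = 1 / (32 * 9 ^ d) + 1 / (32 * 9 ^ d) := by field_simp; norm_num
  linarith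

/-- `f` is regular, or its mean dominates its standard deviation. -/
def IsGood (τ δ : ℝ) (f : Cube n → ℝ) : Prop :=
  IsTauRegular τ f ∨ (𝔼 x, f x ≠ 0 ∧ 4 * 𝔼 x, (f x - 𝔼 y, f y) ^ 2 ≤ δ * (𝔼 x, f x) ^ 2)

lemma isTauRegular_of_expect_sq_eq_zero {f : Cube n → ℝ} (τ : ℝ) (hf : 𝔼 x, f x ^ 2 = 0) :
    IsTauRegular τ f := by
  have h0 : ∀ x, f x = 0 := fun x => by
    have := congrFun ((Fintype.expect_eq_zero_iff_of_nonneg fun x => sq_nonneg (f x)).mp hf) x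
    simpa using this
  intro i
  simp [totalInfluence, influence_eq, coordDeriv, h0]

/-- Every low-degree function has a small set of coordinates whose random restriction is good with
substantial probability. -/
lemma exists_le_prob_isGood {d q m : ℕ} (hq : q ≠ 0) {τ t δ : ℝ} (hτ : 0 < τ)
    (ht1 : t ≤ 1) (hδ0 : 0 < δ) (hδ : δ ≤ 1)
    (hqt : ((2 * q - 1 : ℝ) ^ d) ^ q * t ^ (q - 1) ≤ (τ / 2) ^ q / (8 * 9 ^ d))
    (hm : 512 * 9 ^ d * ((1 - t) ^ m * d) ≤ δ) {g : Cube n → ℝ} (hg : HasDegLE d g) :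
    ∃ H : Finset (Fin n), H.card ≤ m ∧
      1 / (32 * 9 ^ d) ≤ prob fun ρ => IsGood τ δ (restrict H ρ g) := by
  have mono : ∀ {P Q : Cube n → Prop}, (∀ ρ, P ρ → Q ρ) → prob P ≤ prob Q := fun {P Q} h => by
    have := prob_le_add (P := P) (Q := Q) (R := fun _ => False) fun ρ hρ => Or.inl (h ρ hρ)
    simpa [prob] using this
  -- The zero function has mean zero, hence is never concentrated, but it is regular with H = ∅.
  rcases (Finset.expect_nonneg fun x _ => sq_nonneg (g x) : 0 ≤ 𝔼 x, g x ^ 2).eq_or_lt with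
    h0 | hpos
  · refine ⟨∅, Nat.zero_le _, ?_⟩
    have h9 : (1 : ℝ) ≤ 9 ^ d := one_le_pow₀ (by norm_num)
    have hgood : ∀ ρ, IsGood τ δ (restrict ∅ ρ g) := fun ρ => Or.inl (by
      rw [show restrict ∅ ρ g = g from funext fun x => by simp [restrict]]
      exact isTauRegular_of_expect_sq_eq_zero τ h0.symm)
    rw [prob_eq_one hgood, div_le_one (by positivity)]
    linarith
  obtain ⟨H, hH, h | h⟩ := exists_critical_set (influence g) ht1 m
  · refine ⟨H, hH, (le_trans ?_ (le_prob_isTauRegular hq hg hτ h hqt)).trans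
      (mono fun ρ => Or.inl)⟩
    gcongr
    norm_num
  · refine ⟨H, hH, (le_prob_concentrated hg hpos hδ0 hδ (h.trans ?_) hm).trans
      (mono fun ρ => Or.inr)⟩
    rw [mul_assoc]
    exact mul_le_mul_of_nonneg_left hg.totalInfluence_le (pow_nonneg (by linarith) m)

/-! ### Fooling -/

lemma isKWiseIndependent_uniform (k : ℕ) :
    IsKWiseIndependent k (PMF.uniformOfFintype (Cube n)) :=
  isKWiseIndependent_of_expect_walsh fun S hS _ => by rw [expect_uniform, expect_walsh, if_neg hS]

lemma abs_expect_signVal_le (D : PMF (Cube n)) (f : Cube n → ℤˣ) :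
    |expect D fun x => signVal (f x)| ≤ 1 := by
  rw [← sum_toReal D]
  refine (Finset.abs_sum_le_sum_abs _ _).trans (Finset.sum_le_sum fun x _ => ?_)
  rcases Int.units_eq_one_or (f x) with h | h <;> simp [h, signVal]

lemma abs_expect_sub_expect_le_two (D : PMF (Cube n)) (f : Cube n → ℤˣ) :
    |expect D (fun x => signVal (f x)) - 𝔼 x, signVal (f x)| ≤ 2 := by
  rw [← expect_uniform]
  have h1 := abs_expect_signVal_le D f
  have h2 := abs_expect_signVal_le (PMF.uniformOfFintype (Cube n)) f
  rw [abs_le] at *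
  constructor <;> linarith

lemma IsGood.abs_expect_sub_le {d K : ℕ} {τ ε δ : ℝ} (hF : KWiseFools K ε (regularPTF n d τ))
    (hε : 0 ≤ ε) (hδ : 0 ≤ δ) {D : PMF (Cube n)} (hD : IsKWiseIndependent (K + 2 * d) D)
    {g : Cube n → ℝ} (hg : HasDegLE d g) (hgood : IsGood τ δ g) :
    |expect D (fun x => signVal (sgn (g x))) - 𝔼 x, signVal (sgn (g x))| ≤ ε + δ := by
  rcases hgood with hreg | ⟨h0, hV⟩
  · obtain ⟨p, hp, rfl⟩ := hg.exists_evalCube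
    have h := hF D (hD.mono (by omega)) (fun x => sgn (evalCube p x)) ⟨p, hp, hreg, fun _ => rfl⟩
    rw [Fools, expect_uniform] at h
    linarith
  · have h1 := abs_expect_sgn_sub_le (hD.mono (by omega)) hg h0
    have h2 := abs_expect_sgn_sub_le (isKWiseIndependent_uniform (2 * d)) hg h0
    have h3 : 2 * (𝔼 x, (g x - 𝔼 y, g y) ^ 2) / (𝔼 x, g x) ^ 2 ≤ δ / 2 := by
      rw [div_le_iff₀ (by positivity)]
      linarith
    rw [expect_uniform] at h2
    rw [abs_le] at *
    constructor <;> linarith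

lemma expect_eq_expect_restrict {D : PMF (Cube n)} {H : Finset (Fin n)}
    {D' : Cube n → PMF (Cube n)} (hD' : ∀ ρ x, D' ρ x = D (H.piecewise ρ x)) (F : Cube n → ℝ) :
    expect D F = 𝔼 ρ, expect (D' ρ) (restrict H ρ F) := by
  simp only [expect_eq_card_mul, ← Finset.mul_expect]
  rw [← expect_restrict H fun x => (D x).toReal * F x]
  simp only [hD', restrict]

/-- Iterating random restrictions reduces fooling to the regular case. -/
lemma abs_expect_sub_le {d m K : ℕ} {τ ε δ c : ℝ} (hF : KWiseFools K ε (regularPTF n d τ))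
    (hε : 0 ≤ ε) (hδ : 0 ≤ δ) (hc : c ≤ 1)
    (hround : ∀ g : Cube n → ℝ, HasDegLE d g → ∃ H : Finset (Fin n), H.card ≤ m ∧
      c ≤ prob fun ρ => IsGood τ δ (restrict H ρ g)) (r : ℕ) :
    ∀ (D : PMF (Cube n)) (g : Cube n → ℝ), IsKWiseIndependent (K + 2 * d + r * m) D →
      HasDegLE d g →
      |expect D (fun x => signVal (sgn (g x))) - 𝔼 x, signVal (sgn (g x))| ≤
        ε + δ + 2 * (1 - c) ^ r := by
  classical
  induction r with
  | zero =>
    intro D g _ _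
    have := abs_expect_sub_expect_le_two D fun x => sgn (g x)
    rw [pow_zero]
    linarith
  | succ r ih =>
    intro D g hD hg
    obtain ⟨H, hH, hp⟩ := hround g hg
    -- One round spends |H| ≤ m units of independence; what is left serves the remaining r rounds.
    have hD2 : IsKWiseIndependent (K + 2 * d + r * m + H.card) D :=
      hD.mono (by have := Nat.add_one_mul r m; omega)
    choose D' hD'k hD' using exists_restricted hD2
    set F : Cube n → ℝ := fun x => signVal (sgn (g x)) with hFdef
    set b : ℝ := 2 * (1 - c) ^ r with hb
    have hb0 : 0 ≤ b := mul_nonneg zero_le_two (pow_nonneg (by linarith) r)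
    have hleaf : ∀ ρ, |expect (D' ρ) (restrict H ρ F) - 𝔼 x, restrict H ρ F x| ≤
        ε + δ + b * (1 - if IsGood τ δ (restrict H ρ g) then 1 else 0) := by
      intro ρ
      split_ifs with hgood
      · have := hgood.abs_expect_sub_le hF hε hδ ((hD'k ρ).mono (by omega)) (hg.restrict H ρ)
        rw [sub_self, mul_zero, add_zero]
        exact this
      · rw [sub_zero, mul_one]
        exact ih (D' ρ) (restrict H ρ g) (hD'k ρ) (hg.restrict H ρ)
    rw [expect_eq_expect_restrict hD' F, ← expect_restrict H F,
      ← Finset.expect_sub_distrib]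
    calc |𝔼 ρ, (expect (D' ρ) (restrict H ρ F) - 𝔼 x, restrict H ρ F x)|
        ≤ 𝔼 ρ, |expect (D' ρ) (restrict H ρ F) - 𝔼 x, restrict H ρ F x| :=
          Finset.abs_expect_le _ _
      _ ≤ 𝔼 ρ, (ε + δ + b * (1 - if IsGood τ δ (restrict H ρ g) then 1 else 0)) :=
          Finset.expect_le_expect fun ρ _ => hleaf ρ
      _ = ε + δ + b * (1 - prob fun ρ => IsGood τ δ (restrict H ρ g)) := by
          rw [Finset.expect_add_distrib, Fintype.expect_const, ← Finset.mul_expect,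
            Finset.expect_sub_distrib, Fintype.expect_const]
          simp only [prob]
      _ ≤ ε + δ + b * (1 - c) := by gcongr
      _ = _ := by rw [hb, pow_succ]; ring

/-! ### Choice of parameters -/

lemma one_sub_pow_le {t : ℝ} (ht : t ≤ 1) {m L : ℕ} (h : (L : ℝ) ≤ t * m) :
    (1 - t) ^ m ≤ 1 / 2 ^ L := by
  calc (1 - t) ^ m ≤ (Real.exp (-t)) ^ m :=
        pow_le_pow_left₀ (by linarith) (Real.one_sub_le_exp_neg t) m
    _ = Real.exp (-(t * m)) := by rw [← Real.exp_nat_mul]; ring_nf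
    _ ≤ Real.exp (-L) := Real.exp_le_exp.mpr (by linarith)
    _ = 1 / (Real.exp 1) ^ L := by rw [← Real.exp_nat_mul, mul_one, Real.exp_neg, one_div]
    _ ≤ 1 / 2 ^ L := by
        gcongr
        linarith [Real.add_one_le_exp 1]

lemma nine_pow_le {d N : ℕ} (hdN : d ≤ N) : (9 : ℝ) ^ d ≤ 2 ^ (4 * N) := by
  calc (9 : ℝ) ^ d ≤ 16 ^ d := by gcongr; norm_num
    _ ≤ 16 ^ N := pow_le_pow_right₀ (by norm_num) hdN
    _ = _ := by rw [pow_mul]; norm_num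

lemma cast_le_two_pow (N : ℕ) : (N : ℝ) ≤ 2 ^ N := by exact_mod_cast Nat.lt_two_pow_self.le

/-- By the choice of t, (2q)^(dq)·t^q = (τ/32)^q. The claim thus reduces to 256·(18q)^d/τ ≤ 16^q,
where the left side is 2^(O(N²)) and q = N⁴. -/
lemma moment_parameter {d N q : ℕ} {τ t : ℝ} (hN : 2 ≤ N) (hdN : d ≤ N) (hτ : 0 < τ)
    (hτN : 1 / τ ≤ 2 ^ (2 * N)) (hq : q = N ^ 4) (ht : t = τ / (32 * (2 * q) ^ d)) :
    ((2 * q - 1 : ℝ) ^ d) ^ q * t ^ (q - 1) ≤ (τ / 2) ^ q / (8 * 9 ^ d) := by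
  have hq0 : 0 < q := hq ▸ by positivity
  have hq0' : (1 : ℝ) ≤ q := by exact_mod_cast hq0
  have ht0 : 0 < t := ht ▸ by positivity
  have h1 : (256 : ℝ) * (18 * q) ^ d * (1 / τ) ≤ 16 ^ q := by
    have e1 : (18 * q : ℝ) ≤ 2 ^ (5 + 4 * N) := by
      rw [hq, pow_add, mul_comm 4 N, pow_mul]
      push_cast
      have := cast_le_two_pow N
      gcongr
      norm_num
    have e2 : (18 * q : ℝ) ^ d ≤ 2 ^ ((5 + 4 * N) * N) := by
      rw [pow_mul]
      exact (pow_le_pow_left₀ (by positivity) e1 d).trans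
        (pow_le_pow_right₀ (one_le_pow₀ (by norm_num)) hdN)
    calc (256 : ℝ) * (18 * q) ^ d * (1 / τ) ≤ 2 ^ 8 * 2 ^ ((5 + 4 * N) * N) * 2 ^ (2 * N) := by
          gcongr
          norm_num
      _ = 2 ^ (8 + (5 + 4 * N) * N + 2 * N) := by rw [pow_add, pow_add]
      _ ≤ 2 ^ (4 * q) := by
          refine pow_le_pow_right₀ (by norm_num) ?_
          have a1 : 2 * N ≤ N ^ 2 := by nlinarith
          have a2 : 4 * N ^ 2 ≤ N ^ 4 := by nlinarith
          rw [hq]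
          nlinarith
      _ = 16 ^ q := by rw [pow_mul]; norm_num
  have h2 : ((2 * q - 1 : ℝ) ^ d) ^ q * t ^ (q - 1) ≤ ((2 * q : ℝ) ^ d) ^ q * t ^ (q - 1) := by
    have : (2 * q - 1 : ℝ) ^ d ≤ (2 * q) ^ d := pow_le_pow_left₀ (by linarith) (by linarith) d
    have h0 : (0 : ℝ) ≤ (2 * q - 1) ^ d := pow_nonneg (by linarith) d
    gcongr
  refine h2.trans ?_
  have h3 : ((2 * q : ℝ) ^ d) ^ q * t ^ (q - 1) * t = (τ / 32) ^ q := by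
    rw [mul_assoc, ← pow_succ, Nat.sub_add_cancel hq0, ← mul_pow, ht]
    congr 1
    field_simp
  have h4 : ((2 * q : ℝ) ^ d) ^ q * t ^ (q - 1) = (τ / 32) ^ q / t := by
    rw [← h3]; field_simp
  have h5 : (τ / 32) ^ q = (τ / 2) ^ q / 16 ^ q := by rw [← div_pow]; congr 1; ring
  rw [h4, h5, div_div]
  refine div_le_div_of_nonneg_left (by positivity) (by positivity) ?_
  have h6 : (8 : ℝ) * 9 ^ d = 256 * (18 * q) ^ d * (1 / τ) * t := by
    rw [ht, show (18 * q : ℝ) = 9 * (2 * q) by ring, mul_pow 9]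
    field_simp
    norm_num
  rw [h6]
  exact mul_le_mul_of_nonneg_right h1 ht0.le

lemma tail_parameter {d N m κ : ℕ} {τ t : ℝ} (hdN : d ≤ N) (hτ : 0 < τ)
    (hτN : 1 / τ ≤ 2 ^ (2 * N)) (ht1 : t ≤ 1) (hm : ((10 + κ + 7 * N : ℕ) : ℝ) ≤ t * m) :
    512 * 9 ^ d * ((1 - t) ^ m * d) ≤ τ / 2 ^ (κ + 1) := by
  have h1 := one_sub_pow_le ht1 hm
  have h2 : (d : ℝ) ≤ 2 ^ N := (Nat.cast_le.mpr hdN).trans (cast_le_two_pow N)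
  have h3 : 1 / 2 ^ (2 * N) ≤ τ := by
    rw [div_le_iff₀ hτ] at hτN
    rw [div_le_iff₀ (by positivity)]
    linarith
  calc 512 * 9 ^ d * ((1 - t) ^ m * d)
      ≤ 2 ^ 9 * 2 ^ (4 * N) * (1 / 2 ^ (10 + κ + 7 * N) * 2 ^ N) := by
        have := nine_pow_le hdN
        have h0 : (0 : ℝ) ≤ (1 - t) ^ m := pow_nonneg (by linarith) m
        gcongr
        norm_num
    _ = 1 / 2 ^ (2 * N) / 2 ^ (κ + 1) := by
        -- The exponents pay, in order, for 512, 9^d, d, 1/τ and the factor 2^(κ+1) in δ.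
        rw [show 10 + κ + 7 * N = 9 + 4 * N + N + 2 * N + (κ + 1) by ring]
        simp only [pow_add]
        field_simp
    _ ≤ τ / 2 ^ (κ + 1) := by gcongr

lemma round_parameter {N κ r : ℕ} {τ c : ℝ} (hτ : 0 < τ) (hτN : 1 / τ ≤ 2 ^ (2 * N)) (hc : c ≤ 1)
    (hr : ((κ + 2 + 2 * N : ℕ) : ℝ) ≤ c * r) : 2 * (1 - c) ^ r ≤ τ / 2 ^ (κ + 1) := by
  have h1 := one_sub_pow_le hc hr
  have h3 : 1 / 2 ^ (2 * N) ≤ τ := by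
    rw [div_le_iff₀ hτ] at hτN
    rw [div_le_iff₀ (by positivity)]
    linarith
  calc 2 * (1 - c) ^ r ≤ 2 * (1 / 2 ^ (κ + 2 + 2 * N)) := by gcongr
    _ = 1 / 2 ^ (2 * N) / 2 ^ (κ + 1) := by
        rw [show κ + 2 + 2 * N = 1 + 2 * N + (κ + 1) by ring]
        simp only [pow_add]
        field_simp
    _ ≤ τ / 2 ^ (κ + 1) := by gcongr

/-- The left side is 2d + r·m with 1/τ removed from m. -/
lemma size_parameter {d N κ : ℕ} (hd : 1 ≤ d) (hN : 2 ≤ N) (hdN : 2 * d ≤ N) :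
    2 * d + 32 * 9 ^ d * (κ + 2 + 2 * N) * (64 * (2 * N ^ 4) ^ d * (10 + κ + 7 * N)) ≤
      N ^ ((2 * κ + 29) * d) := by
  have two_pow : ∀ k, 2 ^ k ≤ N ^ k := fun k => Nat.pow_le_pow_left hN k
  have h9 : 9 ^ d ≤ N ^ (4 * d) := by
    rw [pow_mul]
    exact Nat.pow_le_pow_left (le_trans (by norm_num) (two_pow 4)) d
  have hq : (2 * N ^ 4) ^ d ≤ N ^ (5 * d) := by
    rw [pow_mul]
    refine Nat.pow_le_pow_left ?_ d
    rw [pow_succ' N 4]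
    exact Nat.mul_le_mul_right _ hN
  have hR : κ + 2 + 2 * N ≤ N ^ (κ + 3) := by
    have h1 : κ + 3 ≤ 2 ^ (κ + 2) := Nat.lt_two_pow_self
    calc κ + 2 + 2 * N ≤ (κ + 3) * N := by nlinarith
      _ ≤ N ^ (κ + 2) * N := Nat.mul_le_mul_right _ (h1.trans (two_pow _))
      _ = _ := (pow_succ _ _).symm
  have hL : 10 + κ + 7 * N ≤ N ^ (κ + 5) := by
    have h1 : κ + 12 ≤ 2 ^ (κ + 4) := by
      have : κ < 2 ^ κ := Nat.lt_two_pow_self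
      rw [pow_add]
      omega
    calc 10 + κ + 7 * N ≤ (κ + 12) * N := by nlinarith
      _ ≤ N ^ (κ + 4) * N := Nat.mul_le_mul_right _ (h1.trans (two_pow _))
      _ = _ := (pow_succ _ _).symm
  have hmain : 32 * 9 ^ d * (κ + 2 + 2 * N) * (64 * (2 * N ^ 4) ^ d * (10 + κ + 7 * N)) ≤
      N ^ (9 * d + 2 * κ + 19) := by
    calc _ ≤ N ^ 5 * N ^ (4 * d) * N ^ (κ + 3) * (N ^ 6 * N ^ (5 * d) * N ^ (κ + 5)) :=
          Nat.mul_le_mul (Nat.mul_le_mul (Nat.mul_le_mul (two_pow 5) h9) hR)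
            (Nat.mul_le_mul (Nat.mul_le_mul (two_pow 6) hq) hL)
      _ = _ := by simp only [← pow_add]; congr 1; ring
  have hsmall : 2 * d ≤ N ^ (9 * d + 2 * κ + 19) :=
    hdN.trans (Nat.le_self_pow (by omega) N)
  calc _ ≤ 2 * N ^ (9 * d + 2 * κ + 19) := by omega
    _ ≤ N * N ^ (9 * d + 2 * κ + 19) := Nat.mul_le_mul_right _ hN
    _ = N ^ (9 * d + 2 * κ + 20) := (pow_succ' _ _).symm
    _ ≤ _ := Nat.pow_le_pow_right (by omega) (by nlinarith)

lemma exists_base {d : ℕ} (hd : 1 ≤ d) {τ : ℝ} (hτ : 0 < τ) :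
    ∃ N : ℕ, 2 ≤ N ∧ 2 * d ≤ N ∧ 1 / τ ≤ 2 ^ (2 * N) ∧
      (N : ℝ) ≤ (d * max 2 (Real.log (1 / τ))) ^ 2 := by
  set B : ℝ := d * max 2 (Real.log (1 / τ)) with hB
  have hd' : (1 : ℝ) ≤ d := by exact_mod_cast hd
  have h2 : (2 : ℝ) ≤ max 2 (Real.log (1 / τ)) := le_max_left _ _
  have hB2 : 2 * (d : ℝ) ≤ B := by nlinarith
  have hlog : Real.log (1 / τ) ≤ B := (le_max_right 2 _).trans (by nlinarith)
  have hle : B ≤ ⌈B⌉₊ := Nat.le_ceil B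
  have hdN : 2 * d ≤ ⌈B⌉₊ := by
    have : ((2 * d : ℕ) : ℝ) ≤ ⌈B⌉₊ := by push_cast; linarith
    exact_mod_cast this
  -- B ≥ 2 gives ⌈B⌉ ≤ B + 1 ≤ B², so rounding up only doubles the final exponent.
  refine ⟨⌈B⌉₊, by omega, hdN, ?_, ?_⟩
  · calc 1 / τ = Real.exp (Real.log (1 / τ)) := (Real.exp_log (by positivity)).symm
      _ ≤ Real.exp ⌈B⌉₊ := Real.exp_le_exp.mpr (hlog.trans hle)
      _ = Real.exp 1 ^ ⌈B⌉₊ := by rw [← Real.exp_nat_mul, mul_one]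
      _ ≤ 4 ^ ⌈B⌉₊ := by gcongr; linarith [Real.exp_one_lt_d9]
      _ = _ := by rw [pow_mul]; norm_num
  · have := Nat.ceil_lt_add_one (show 0 ≤ B by linarith)
    nlinarith

end PTF

open PTF in
theorem mainTheorem5 :
    ∀ η : ℝ, 0 < η → ∃ C : ℕ, ∀ (d : ℕ), 1 ≤ d → ∀ (τ ε : ℝ), 0 < τ → τ ≤ ε →
      ∀ (n K : ℕ), KWiseFools K ε (regularPTF n d τ) →
        KWiseFools (K + extraIndependence C d τ) ((1 + η) * ε) (degreePTF n d) := by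
  intro η hη
  obtain ⟨κ, hκ⟩ := pow_unbounded_of_one_lt (1 / η) one_lt_two
  -- The exponent 2κ + 29 comes from `size_parameter`, the factor 2 from bounding N by the square of
  -- the base.
  refine ⟨2 * (2 * κ + 29), fun d hd τ ε hτ hτε n K hF D hD f hf => ?_⟩
  obtain ⟨p, hp, hfp⟩ := hf
  have hε : 0 < ε := hτ.trans_le hτε
  have hηε : 0 < η * ε := mul_pos hη hε
  -- For τ ≥ 1 every polynomial is τ-regular.
  rcases le_or_gt 1 τ with hτ1 | hτ1
  · have hreg : IsTauRegular τ (evalCube p) := fun i =>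
      (Finset.single_le_sum (fun j _ => influence_nonneg (evalCube p) j) (Finset.mem_univ i)).trans
        (le_mul_of_one_le_left (totalInfluence_nonneg _) hτ1)
    have h := hF D (hD.mono (by omega)) f ⟨p, hp, hreg, hfp⟩
    rw [Fools] at *
    linarith
  obtain ⟨N, hN, hdN, hτN, hNB⟩ := exists_base hd hτ
  set q : ℕ := N ^ 4 with hq
  set t : ℝ := τ / (32 * (2 * q) ^ d) with ht
  set Λ : ℕ := 10 + κ + 7 * N with hΛ
  set m : ℕ := ⌈(Λ : ℝ) / t⌉₊ with hm
  set c : ℝ := 1 / (32 * 9 ^ d) with hc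
  set r : ℕ := 32 * 9 ^ d * (κ + 2 + 2 * N) with hr
  set δ : ℝ := τ / 2 ^ (κ + 1) with hδ
  have hq0 : q ≠ 0 := by positivity
  have hq1 : (1 : ℝ) ≤ q := by exact_mod_cast Nat.one_le_iff_ne_zero.mpr hq0
  have ht0 : 0 < t := by positivity
  have ht1 : t ≤ 1 := by
    have : (1 : ℝ) ≤ (2 * q) ^ d := one_le_pow₀ (by linarith)
    rw [ht, div_le_one (by positivity)]
    linarith
  have hc1 : c ≤ 1 := by
    have : (1 : ℝ) ≤ 9 ^ d := one_le_pow₀ (by norm_num)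
    rw [hc, div_le_one (by positivity)]
    linarith
  have hδ0 : 0 < δ := by positivity
  have hδ1 : δ ≤ 1 := by
    have : (1 : ℝ) ≤ 2 ^ (κ + 1) := one_le_pow₀ (by norm_num)
    rw [hδ, div_le_one (by positivity)]
    linarith
  have hδη : 2 * δ ≤ η * ε := by
    have h1 : 1 / 2 ^ κ ≤ η := by
      rw [div_lt_iff₀ hη] at hκ
      rw [div_le_iff₀ (by positivity)]
      linarith
    calc 2 * δ = 1 / 2 ^ κ * τ := by rw [hδ, pow_succ]; field_simp
      _ ≤ η * ε := mul_le_mul h1 hτε hτ.le hη.le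
  have hmt : (Λ : ℝ) ≤ t * m := by
    have := Nat.le_ceil ((Λ : ℝ) / t)
    rw [div_le_iff₀ ht0] at this
    linarith
  have hrc : ((κ + 2 + 2 * N : ℕ) : ℝ) ≤ c * r := by
    rw [hc, hr]
    push_cast
    field_simp
    exact le_rfl
  have hround : ∀ g : Cube n → ℝ, HasDegLE d g → ∃ H : Finset (Fin n), H.card ≤ m ∧
      c ≤ prob fun ρ => IsGood τ δ (restrict H ρ g) := fun g hg =>
    exists_le_prob_isGood hq0 hτ ht1 hδ0 hδ1
      (moment_parameter hN (by omega) hτ hτN hq ht) (tail_parameter (by omega) hτ hτN ht1 hmt) hg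
  have hsize : 2 * d + r * m ≤ extraIndependence (2 * (2 * κ + 29)) d τ := by
    have hm2 : (m : ℝ) ≤ (64 * (2 * N ^ 4) ^ d * Λ : ℕ) / τ := by
      -- Rounding a number that is at least 1 at most doubles it, so 32 becomes 64.
      have h1 : (1 : ℝ) ≤ Λ / t := by
        rw [le_div_iff₀ ht0]
        have : (10 : ℝ) ≤ Λ := by exact_mod_cast (by omega : 10 ≤ Λ)
        linarith
      have h2 := (Nat.ceil_lt_add_one (zero_le_one.trans h1)).le
      have h3 : ((64 * (2 * N ^ 4) ^ d * Λ : ℕ) : ℝ) / τ = 2 * (Λ / t) := by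
        rw [ht, hq]
        push_cast
        field_simp
        ring
      rw [h3]
      linarith
    have h := size_parameter (κ := κ) hd hN hdN
    have h' : ((2 * d + r * (64 * (2 * N ^ 4) ^ d * Λ) : ℕ) : ℝ) ≤
        (N : ℝ) ^ ((2 * κ + 29) * d) := by exact_mod_cast h
    refine Nat.cast_le (α := ℝ) |>.mp (le_trans ?_ (Nat.le_ceil _))
    calc ((2 * d + r * m : ℕ) : ℝ)
        ≤ (2 * d : ℕ) / τ + r * ((64 * (2 * N ^ 4) ^ d * Λ : ℕ) / τ) := by
          rw [Nat.cast_add, Nat.cast_mul r m]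
          refine add_le_add ?_ (mul_le_mul_of_nonneg_left hm2 (Nat.cast_nonneg r))
          exact le_div_self (Nat.cast_nonneg _) hτ hτ1.le
      _ = 1 / τ * (2 * d + r * (64 * (2 * N ^ 4) ^ d * Λ) : ℕ) := by
          rw [Nat.cast_add, Nat.cast_mul r]; ring
      _ ≤ 1 / τ * (N : ℝ) ^ ((2 * κ + 29) * d) := by gcongr
      _ ≤ 1 / τ * ((d * max 2 (Real.log (1 / τ))) ^ 2) ^ ((2 * κ + 29) * d) := by gcongr
      _ = _ := by rw [← pow_mul, mul_assoc 2]
  have hfinal := abs_expect_sub_le hF hε.le hδ0.le hc1 hround r D (evalCube p)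
    (hD.mono (by omega)) (hasDegLE_evalCube hp)
  have hlast := round_parameter hτ hτN hc1 hrc
  rw [Fools, expect_uniform]
  simp only [hfp]
  -- The error is ε + δ + 2(1-c)^r ≤ ε + 2δ ≤ (1 + η)ε.
  linarith
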